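/- Let $\Theta=(\theta_{jk})$ be a real skew-symmetric $4\times4$ matrix, let $A_\Theta$ be the C*-algebra generated by unitaries $U_1,\dots,U_4$ with $U_jU_k=e^{2\pi i\theta_{jk}}U_kU_j$ (the noncommutative 4-torus, in its standard representation on $\ell^2(\mathbb Z^4)$), let $A_\Theta^\infty$ be the $*$-algebra of smooth vectors of the action $\alpha_s(U_j)=e^{is_j}U_j$ of $\mathbb R^4$, and let $\delta_1,\dots,\delta_4$ be the canonical $*$-derivations of $A_\Theta^\infty$, $\delta_jU_k=2\pi i\,\delta_{jk}U_k$ ($\delta_{jk}$ the Kronecker symbol). Let $\mathcal X_\Theta$ be the free left $A_\Theta^\infty$-module with basis $\partial_1,\dots,\partial_4$ and $\mathcal D_\Theta$ the real Lie algebra of $*$-derivations of $A_\Theta^\infty$; we also write $\partial_j$ for $\delta_j\in\mathcal D_\Theta$. Let $f=f^*\in A_\Theta^\infty$ and let $\langle\sum_i a_i\partial_i,\sum_j b_j\partial_j\rangle=\sum_i a_ie^fb_i^*$ be the conformally flat metric on $\mathcal X_\Theta$, $\langle\partial_i,\partial_j\rangle=e^f\delta_{ij}$. A Levi-Civita connection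 is a map $D:\mathcal D_\Theta\times\mathcal X_\Theta\to\mathcal X_\Theta$, $(Z,X)\mapsto D_ZX$, real-linear in $Z$ and complex-linear in $X$, with $D_Z(aX)=Z(a)X+aD_ZX$, which is compatible with the metric, $Z\langle X,Y\rangle=\langle D_ZX,Y\rangle+\langle X,D_ZY\rangle$, torsion free, $D_{\partial_i}\partial_j=D_{\partial_j}\partial_i$, and for which all $\langle D_{\partial_i}\partial_j,\partial_k\rangle$ are self-adjoint. Its curvature is $R(Z,W)=D_WD_Z-D_ZD_W+D_{[Z,W]}$, and with $R_{ijkl}=\langle R(\partial_i,\partial_j)\partial_k,\partial_l\rangle$ and $(g^{ij})$ the inverse of the matrix $(\langle\partial_i,\partial_j\rangle)$, its scalar curvature is $R=\sum_{i,k}g^{ik}\sum_{j,l}g^{jl}R_{ijkl}=\sum_{i,j}e^{-2f}R_{ijij}$. Then Levi-Civita connections exist, and the scalar curvature of every one of them is $$R=\sum_{i=1}^4\Big(-3e^{-2f}\,\delta_i^2(e^f)+\tfrac32e^{-2f}\,\delta_i(e^f)\,e^{-f}\,\delta_i(e^f)\Big)$$ and equals $$R=-3e^{-f}K(\nabla)\Big(\sum_{i=1}^4\delta_i^2f\Big)+3e^{-f}\sum_{i=1}^4H(\nabla,\nabla)\big(\delta_i(f)\,\delta_i(f)\big).$$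 Here $\nabla=-\mathrm{ad}_f$ is the modular derivation, $\nabla x=xf-fx$ on $A_\Theta$, and $K$, $H$ are the entire functions $$K(s)=\frac{e^s-1}{s},\qquad H(s,t)=\frac{s(e^t-1)(-3e^s-1)+t(e^s-1)(e^t+3)}{2st(s+t)}$$ (removable singularities removed). With $K(s)=\sum_mk_ms^m$ and $H(s,t)=\sum_{m,n}h_{mn}s^mt^n$ their Taylor series at the origin, $K(\nabla)x=\sum_mk_m\nabla^mx$ and $H(\nabla,\nabla)(xy)=\sum_{m,n}h_{mn}\nabla^m(x)\nabla^n(y)$; these series converge in the norm of $A_\Theta$ for all $x,y\in A_\Theta$. -/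

import Mathlib

open scoped Nat ContDiff

noncomputable section

namespace NCTorus

/-! ### The C*-algebra of the noncommutative torus -/

/-- The Hilbert space `ℓ²(ι)`. -/
abbrev Ell2 (ι : Type) : Type := lp (fun _ : ι => ℂ) 2

/-- `(W ξ)(m) = c m * ξ (σ m)`, as a linear map of `ℓ²(ι)`. -/
def weightedShiftLin {ι : Type} (σ : Equiv.Perm ι) (c : ι → Circle) : Ell2 ι →ₗ[ℂ] Ell2 ι where
  toFun ξ := ⟨fun m => (c m : ℂ) * ξ (σ m), by
    have h := lp.memℓp ξ
    change Memℓp (fun m => (c m : ℂ) * ξ (σ m)) 2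
    rw [memℓp_gen_iff (by norm_num)] at h ⊢
    simpa only [norm_mul, Circle.norm_coe, one_mul, Function.comp_def] using (σ.summable_iff).2 h⟩
  map_add' ξ η := by
    ext m
    exact mul_add _ _ _
  map_smul' a ξ := by
    ext m
    exact mul_left_comm _ _ _

@[simp] theorem weightedShiftLin_apply {ι : Type} (σ : Equiv.Perm ι) (c : ι → Circle)
    (ξ : Ell2 ι) (m : ι) : weightedShiftLin σ c ξ m = (c m : ℂ) * ξ (σ m) := rfl

/-- The unitary `(W ξ)(m) = c m * ξ (σ m)` of `ℓ²(ι)`. -/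
def weightedShift {ι : Type} (σ : Equiv.Perm ι) (c : ι → Circle) : Ell2 ι ≃ₗᵢ[ℂ] Ell2 ι where
  toLinearEquiv := LinearEquiv.ofLinearMap (weightedShiftLin σ c)
    (weightedShiftLin σ.symm fun m => (c (σ.symm m))⁻¹)
    (by ext ξ m; simp)
    (by ext ξ m; simp)
  norm_map' ξ := by
    change ‖weightedShiftLin σ c ξ‖ = ‖ξ‖
    rw [lp.norm_eq_tsum_rpow (by norm_num), lp.norm_eq_tsum_rpow (by norm_num)]
    congr 1
    simp only [weightedShiftLin_apply, norm_mul, Circle.norm_coe, one_mul]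
    exact σ.tsum_eq fun m => ‖ξ m‖ ^ (2 : ENNReal).toReal

@[simp] theorem weightedShift_apply {ι : Type} (σ : Equiv.Perm ι) (c : ι → Circle)
    (ξ : Ell2 ι) (m : ι) : weightedShift σ c ξ m = (c m : ℂ) * ξ (σ m) := rfl

@[simp] theorem weightedShift_symm_apply {ι : Type} (σ : Equiv.Perm ι) (c : ι → Circle)
    (ξ : Ell2 ι) (m : ι) :
    (weightedShift σ c).symm ξ m = ((c (σ.symm m))⁻¹ : Circle) * ξ (σ.symm m) := rfl

/-- Bounded operators on `ℓ²(ℤⁿ)`. -/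
abbrev Op (n : ℕ) : Type := Ell2 (Fin n → ℤ) →L[ℂ] Ell2 (Fin n → ℤ)

/-- The twisted translation `U_j e_m = exp (π i ∑ l, θ_{jl} m_l) e_{m + ε_j}` of `ℓ²(ℤⁿ)`
(for skew-symmetric `Θ`, where `θ_{jj} = 0`). -/
def genU {n : ℕ} (Θ : Matrix (Fin n) (Fin n) ℝ) (j : Fin n) : unitary (Op n) :=
  Unitary.linearIsometryEquiv.symm
    (weightedShift (Equiv.subRight (Pi.single j 1))
      fun m => Circle.exp (Real.pi * ∑ l, Θ j l * (m l : ℝ)))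

/-- The diagonal unitary `W_s e_m = exp (i ⟨s, m⟩) e_m` of `ℓ²(ℤⁿ)`. -/
def diagW {n : ℕ} (s : Fin n → ℝ) : unitary (Op n) :=
  Unitary.linearIsometryEquiv.symm
    (weightedShift (Equiv.refl _) fun m => Circle.exp (∑ l, s l * (m l : ℝ)))

theorem genU_apply {n : ℕ} (Θ : Matrix (Fin n) (Fin n) ℝ) (j : Fin n)
    (ξ : Ell2 (Fin n → ℤ)) (m : Fin n → ℤ) :
    (genU Θ j : Op n) ξ m =
      (Circle.exp (Real.pi * ∑ l, Θ j l * (m l : ℝ)) : ℂ) * ξ (m - Pi.single j 1) := rfl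

theorem diagW_apply {n : ℕ} (s : Fin n → ℝ) (ξ : Ell2 (Fin n → ℤ)) (m : Fin n → ℤ) :
    (diagW s : Op n) ξ m = (Circle.exp (∑ l, s l * (m l : ℝ)) : ℂ) * ξ m := rfl

/-- The defining relations `U_j U_k = exp (2 π i θ_{jk}) U_k U_j`. -/
theorem genU_comm {n : ℕ} (Θ : Matrix (Fin n) (Fin n) ℝ) (hΘ : Θ.transpose = -Θ) (j k : Fin n) :
    (genU Θ j : Op n) * genU Θ k =
      Complex.exp (2 * Real.pi * Complex.I * Θ j k) • ((genU Θ k : Op n) * genU Θ j) := by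
  have hs : Θ k j = -Θ j k := by
    have := congrFun (congrFun hΘ j) k
    simpa using this
  have key : ∀ (i l : Fin n) (m : Fin n → ℤ),
      ∑ x, Θ i x * (((m - Pi.single l 1 : Fin n → ℤ) x : ℤ) : ℝ) =
        (∑ x, Θ i x * (m x : ℝ)) - Θ i l := by
    intro i l m
    simp [mul_sub, Finset.sum_sub_distrib, Pi.single_apply]
  ext ξ m
  have e1 : ((genU Θ j : Op n) * genU Θ k) ξ m =
      (genU Θ j : Op n) ((genU Θ k : Op n) ξ) m := rfl
  have e2 : (Complex.exp (2 * Real.pi * Complex.I * Θ j k) •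
      ((genU Θ k : Op n) * genU Θ j)) ξ m = Complex.exp (2 * Real.pi * Complex.I * Θ j k) *
        (genU Θ k : Op n) ((genU Θ j : Op n) ξ) m := rfl
  rw [e1, e2]
  simp only [genU_apply, key, Circle.coe_exp, hs]
  rw [sub_right_comm, ← mul_assoc, ← mul_assoc, ← mul_assoc, ← Complex.exp_add,
    ← Complex.exp_add, ← Complex.exp_add]
  congr 2
  push_cast
  ring

/-- The C*-algebra generated by `U_1, …, U_n`, inside the bounded operators on `ℓ²(ℤⁿ)`. -/
def torusSubalgebra {n : ℕ} (Θ : Matrix (Fin n) (Fin n) ℝ) : StarSubalgebra ℂ (Op n) :=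
  (StarAlgebra.adjoin ℂ (Set.range fun j => (genU Θ j : Op n))).topologicalClosure

/-- The C*-algebra `A_Θ` of the noncommutative `n`-torus: the algebra generated by unitaries with
`U_j U_k = exp (2 π i θ_{jk}) U_k U_j`, in its standard faithful representation on `ℓ²(ℤⁿ)`. -/
def Torus {n : ℕ} (Θ : Matrix (Fin n) (Fin n) ℝ) : Type := torusSubalgebra Θ

theorem isClosed_torusSubalgebra {n : ℕ} (Θ : Matrix (Fin n) (Fin n) ℝ) :
    IsClosed (torusSubalgebra Θ : Set (Op n)) :=
  StarSubalgebra.isClosed_topologicalClosure _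

instance {n : ℕ} (Θ : Matrix (Fin n) (Fin n) ℝ) : CStarAlgebra (Torus Θ) :=
  haveI : IsClosed (torusSubalgebra Θ : Set (Op n)) := isClosed_torusSubalgebra Θ
  inferInstanceAs (CStarAlgebra (torusSubalgebra Θ))

/-- The usual order of a C*-algebra: `a ≤ b` iff `b - a` is self-adjoint with spectrum in
`[0, ∞)`. -/
instance {n : ℕ} (Θ : Matrix (Fin n) (Fin n) ℝ) : PartialOrder (Torus Θ) :=
  CStarAlgebra.spectralOrder _

instance {n : ℕ} (Θ : Matrix (Fin n) (Fin n) ℝ) : StarOrderedRing (Torus Θ) :=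
  CStarAlgebra.spectralOrderedRing _

/-- The inclusion of `A_Θ` in the bounded operators. -/
def toOp {n : ℕ} (Θ : Matrix (Fin n) (Fin n) ℝ) : Torus Θ →⋆ₐ[ℂ] Op n :=
  (torusSubalgebra Θ).subtype

/-- `U_j` as an element of `A_Θ`. -/
def U {n : ℕ} (Θ : Matrix (Fin n) (Fin n) ℝ) (j : Fin n) : Torus Θ :=
  ⟨genU Θ j, StarSubalgebra.le_topologicalClosure _
    (StarAlgebra.subset_adjoin ℂ _ ⟨j, rfl⟩)⟩

/-! ### The action of `ℝⁿ`, smooth vectors and the canonical derivations -/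

theorem diagW_conj_genU {n : ℕ} (Θ : Matrix (Fin n) (Fin n) ℝ) (s : Fin n → ℝ) (j : Fin n) :
    Unitary.conjStarAlgAut ℂ (Op n) (diagW s) (genU Θ j) =
      Complex.exp (Complex.I * s j) • (genU Θ j : Op n) := by
  rw [Unitary.conjStarAlgAut_apply]
  have h : (diagW s : Op n) * genU Θ j =
      Complex.exp (Complex.I * s j) • ((genU Θ j : Op n) * diagW s) := by
    ext ξ m
    have e1 : ((diagW s : Op n) * genU Θ j) ξ m =
      (diagW s : Op n) ((genU Θ j : Op n) ξ) m := rfl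
    have e2 : (Complex.exp (Complex.I * s j) • ((genU Θ j : Op n) * diagW s)) ξ m =
      Complex.exp (Complex.I * s j) * (genU Θ j : Op n) ((diagW s : Op n) ξ) m := rfl
    have key : ∑ x, s x * (((m - Pi.single j 1 : Fin n → ℤ) x : ℤ) : ℝ) =
        (∑ x, s x * (m x : ℝ)) - s j := by
      simp [mul_sub, Finset.sum_sub_distrib, Pi.single_apply]
    rw [e1, e2]
    simp only [genU_apply, diagW_apply, key, Circle.coe_exp]
    rw [← mul_assoc, ← mul_assoc, ← mul_assoc, ← Complex.exp_add,
      ← Complex.exp_add, ← Complex.exp_add]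
    congr 2
    push_cast
    ring
  rw [h, smul_mul_assoc, mul_assoc]
  simp

theorem conj_mem {n : ℕ} (Θ : Matrix (Fin n) (Fin n) ℝ) (s : Fin n → ℝ) (a : Torus Θ) :
    Unitary.conjStarAlgAut ℂ (Op n) (diagW s) (toOp Θ a) ∈ torusSubalgebra Θ := by
  have hc : Continuous (Unitary.conjStarAlgAut ℂ (Op n) (diagW s)) := by
    have : (Unitary.conjStarAlgAut ℂ (Op n) (diagW s) : Op n → Op n) =
        fun x => (diagW s : Op n) * x * star (diagW s : Op n) := by
      ext1 x
      simp
    rw [this]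
    fun_prop
  have h : torusSubalgebra Θ ≤ (torusSubalgebra Θ).comap
      (Unitary.conjStarAlgAut ℂ (Op n) (diagW s) : Op n →⋆ₐ[ℂ] Op n) := by
    refine StarSubalgebra.topologicalClosure_minimal (StarAlgebra.adjoin_le ?_)
      ((isClosed_torusSubalgebra Θ).preimage hc)
    rintro _ ⟨j, rfl⟩
    change Unitary.conjStarAlgAut ℂ (Op n) (diagW s) (genU Θ j) ∈ torusSubalgebra Θ
    rw [diagW_conj_genU]
    exact (torusSubalgebra Θ).smul_mem (U Θ j).2 _
  exact h a.2

/-- The action `α` of `ℝⁿ` on `A_Θ`, with `α_s U_j = exp (i s_j) U_j`. -/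
def action {n : ℕ} (Θ : Matrix (Fin n) (Fin n) ℝ) (s : Fin n → ℝ) : Torus Θ →⋆ₐ[ℂ] Torus Θ :=
  StarAlgHom.codRestrict
    ((Unitary.conjStarAlgAut ℂ (Op n) (diagW s) : Op n →⋆ₐ[ℂ] Op n).comp (toOp Θ))
    (torusSubalgebra Θ) (conj_mem Θ s)

theorem toOp_action {n : ℕ} (Θ : Matrix (Fin n) (Fin n) ℝ) (s : Fin n → ℝ) (a : Torus Θ) :
    toOp Θ (action Θ s a) = (diagW s : Op n) * toOp Θ a * star (diagW s : Op n) := rfl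

theorem toOp_injective {n : ℕ} (Θ : Matrix (Fin n) (Fin n) ℝ) : Function.Injective (toOp Θ) :=
  Subtype.val_injective

theorem action_U {n : ℕ} (Θ : Matrix (Fin n) (Fin n) ℝ) (s : Fin n → ℝ) (j : Fin n) :
    action Θ s (U Θ j) = Complex.exp (Complex.I * s j) • U Θ j :=
  toOp_injective Θ (diagW_conj_genU Θ s j)

theorem diagW_add {n : ℕ} (s t : Fin n → ℝ) : diagW (s + t) = diagW s * diagW t := by
  apply Subtype.ext
  ext ξ m
  have e : ((diagW s * diagW t : unitary (Op n)) : Op n) ξ m =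
    (diagW s : Op n) ((diagW t : Op n) ξ) m := rfl
  rw [e]
  simp only [diagW_apply, ← mul_assoc, Pi.add_apply, add_mul, Finset.sum_add_distrib,
    Circle.exp_add, Circle.coe_mul]

theorem action_add {n : ℕ} (Θ : Matrix (Fin n) (Fin n) ℝ) (s t : Fin n → ℝ) (a : Torus Θ) :
    action Θ (s + t) a = action Θ s (action Θ t a) := by
  apply toOp_injective
  simp only [toOp_action, diagW_add, Submonoid.coe_mul, star_mul, mul_assoc]

theorem continuous_action {n : ℕ} (Θ : Matrix (Fin n) (Fin n) ℝ) (s : Fin n → ℝ) :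
    Continuous (action Θ s) :=
  AddMonoidHomClass.continuous_of_bound (action Θ s) 1 fun x => by
    simpa only [one_mul] using NonUnitalStarAlgHom.norm_apply_le (action Θ s) x

/-- The involutive subalgebra `A_Θ^∞` of smooth vectors of the action `α`. -/
def smoothSubalgebra {n : ℕ} (Θ : Matrix (Fin n) (Fin n) ℝ) : StarSubalgebra ℂ (Torus Θ) where
  carrier := {a | ContDiff ℝ ∞ fun s => action Θ s a}
  mul_mem' {a b} ha hb := by
    simp only [Set.mem_ofPred_eq, map_mul] at *
    exact ha.mul hb
  add_mem' {a b} ha hb := by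
    simp only [Set.mem_ofPred_eq, map_add] at *
    exact ha.add hb
  algebraMap_mem' r := by
    simp only [Set.mem_ofPred_eq, AlgHomClass.commutes]
    exact contDiff_const
  star_mem' {a} ha := by
    simp only [Set.mem_ofPred_eq, map_star] at *
    exact (starL' ℝ : Torus Θ ≃L[ℝ] Torus Θ).contDiff.comp ha

/-- The smooth noncommutative torus `A_Θ^∞`. -/
abbrev Smooth {n : ℕ} (Θ : Matrix (Fin n) (Fin n) ℝ) : Type := smoothSubalgebra Θ

theorem contDiff_action {n : ℕ} {Θ : Matrix (Fin n) (Fin n) ℝ} (a : Smooth Θ) :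
    ContDiff ℝ ∞ fun s => action Θ s a := a.2

theorem differentiable_action {n : ℕ} {Θ : Matrix (Fin n) (Fin n) ℝ} (a : Smooth Θ) :
    Differentiable ℝ fun s => action Θ s (a : Torus Θ) :=
  (contDiff_action a).differentiable (by simp)

/-- The derivative of the orbit map `s ↦ α_s a` is `α_s` of its derivative at `0`. -/
theorem action_fderiv {n : ℕ} {Θ : Matrix (Fin n) (Fin n) ℝ} (a : Smooth Θ) (s v : Fin n → ℝ) :
    action Θ s (fderiv ℝ (fun t => action Θ t (a : Torus Θ)) 0 v) =
      fderiv ℝ (fun t => action Θ t (a : Torus Θ)) s v := by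
  let L : Torus Θ →L[ℝ] Torus Θ :=
    ⟨((action Θ s : Torus Θ →⋆ₐ[ℂ] Torus Θ) : Torus Θ →ₗ[ℂ] Torus Θ).restrictScalars ℝ,
      continuous_action Θ s⟩
  have h1 : HasFDerivAt (fun t => action Θ t (a : Torus Θ))
      (fderiv ℝ (fun t => action Θ t (a : Torus Θ)) 0) 0 :=
    (differentiable_action a 0).hasFDerivAt
  have h2 : HasFDerivAt (fun t => action Θ t (a : Torus Θ))
      (fderiv ℝ (fun t => action Θ t (a : Torus Θ)) s) (s + 0) := by
    rw [add_zero]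
    exact (differentiable_action a s).hasFDerivAt
  have h3 := L.hasFDerivAt.comp 0 h1
  have h4 := h2.comp 0 ((hasFDerivAt_id (𝕜 := ℝ) (0 : Fin n → ℝ)).const_add s)
  have h5 : (L ∘ fun t => action Θ t (a : Torus Θ)) =
      (fun t => action Θ t (a : Torus Θ)) ∘ fun t => s + id t := by
    ext1 t
    exact (action_add Θ s t a).symm
  have h6 := (show HasFDerivAt (L ∘ fun t => action Θ t (a : Torus Θ)) _ 0 from h3)
  rw [h5] at h6
  exact congrArg (fun M : (Fin n → ℝ) →L[ℝ] Torus Θ => M v) (h6.unique h4)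

/-- The canonical derivation `δ_j` of `A_Θ^∞`: the infinitesimal generator of the action in the
`j`-th direction, normalised so that `δ_j U_k = 2 π i δ_{jk} U_k`. -/
def delta {n : ℕ} (Θ : Matrix (Fin n) (Fin n) ℝ) (j : Fin n) : Smooth Θ →ₗ[ℂ] Smooth Θ where
  toFun a := ⟨((2 * Real.pi : ℝ) : ℂ) •
    fderiv ℝ (fun s => action Θ s (a : Torus Θ)) 0 (Pi.single j 1), by
      refine (smoothSubalgebra Θ).smul_mem ?_ _
      change ContDiff ℝ ∞ _
      simp only [action_fderiv]
      exact ((contDiff_action a).fderiv_right (m := ∞) (by simp)).clm_apply contDiff_const⟩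
  map_add' a b := by
    apply Subtype.ext
    have := fderiv_fun_add (differentiable_action a 0) (differentiable_action b 0)
    simp only [AddMemClass.coe_add, map_add, this, add_apply, smul_add]
  map_smul' c a := by
    apply Subtype.ext
    have := fderiv_fun_const_smul (differentiable_action a 0) c
    simp only [SetLike.val_smul, map_smul, this, smul_apply,
      RingHom.id_apply]
    rw [smul_comm]

theorem coe_delta {n : ℕ} (Θ : Matrix (Fin n) (Fin n) ℝ) (j : Fin n) (a : Smooth Θ) :
    (delta Θ j a : Torus Θ) = ((2 * Real.pi : ℝ) : ℂ) •
      fderiv ℝ (fun s => action Θ s (a : Torus Θ)) 0 (Pi.single j 1) := rfl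

theorem delta_mul {n : ℕ} (Θ : Matrix (Fin n) (Fin n) ℝ) (j : Fin n) (a b : Smooth Θ) :
    delta Θ j (a * b) = delta Θ j a * b + a * delta Θ j b := by
  apply Subtype.ext
  have := fderiv_fun_mul' (differentiable_action a 0) (differentiable_action b 0)
  have h0 : ∀ x : Torus Θ, action Θ 0 x = x := by
    intro x
    have h1 : (diagW (0 : Fin n → ℝ)) = 1 := by
      have := diagW_add (0 : Fin n → ℝ) 0
      rw [add_zero] at this
      exact (mul_eq_left.1 this.symm)
    apply toOp_injective
    rw [toOp_action, h1]
    simp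
  simp only [coe_delta, AddMemClass.coe_add, MulMemClass.coe_mul, map_mul]
  rw [show fderiv ℝ (fun s => action Θ s (a : Torus Θ) * action Θ s (b : Torus Θ)) 0 = _ from this]
  rw [add_apply, smul_apply, smul_apply, h0, h0, add_comm, smul_add, smul_mul_assoc,
    mul_smul_comm]
  rfl

theorem delta_star {n : ℕ} (Θ : Matrix (Fin n) (Fin n) ℝ) (j : Fin n) (a : Smooth Θ) :
    delta Θ j (star a) = star (delta Θ j a) := by
  apply Subtype.ext
  have := (differentiable_action a 0).hasFDerivAt.star.fderiv
  simp only [coe_delta, StarMemClass.coe_star, map_star, this]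
  simp

attribute [local instance] LieRing.ofAssociativeRing LieAlgebra.ofAssociativeAlgebra

/-- The real Lie algebra `𝒟_Θ` of `*`-derivations of `A_Θ^∞`. -/
def starDerivations {n : ℕ} (Θ : Matrix (Fin n) (Fin n) ℝ) :
    LieSubalgebra ℝ (Module.End ℂ (Smooth Θ)) where
  carrier := {D | (∀ a b, D (a * b) = D a * b + a * D b) ∧ ∀ a, D (star a) = star (D a)}
  add_mem' {D E} hD hE := by
    refine ⟨fun a b => ?_, fun a => ?_⟩
    · simp only [LinearMap.add_apply, hD.1, hE.1, add_mul, mul_add]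
      abel
    · simp only [LinearMap.add_apply, hD.2, hE.2, star_add]
  zero_mem' := ⟨by simp, by simp⟩
  smul_mem' c D hD := by
    refine ⟨fun a b => ?_, fun a => ?_⟩
    · simp [hD.1]
    · simp [hD.2]
  lie_mem' {D E} hD hE := by
    refine ⟨fun a b => ?_, fun a => ?_⟩
    · simp only [Ring.lie_def, LinearMap.sub_apply, Module.End.mul_apply, hD.1, hE.1, map_add,
        sub_mul, mul_sub]
      abel
    · simp only [Ring.lie_def, LinearMap.sub_apply, Module.End.mul_apply, hD.2, hE.2, star_sub]

/-- The canonical derivation `∂_j` as an element of `𝒟_Θ`. -/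
def partialDer {n : ℕ} (Θ : Matrix (Fin n) (Fin n) ℝ) (j : Fin n) : starDerivations Θ :=
  ⟨delta Θ j, delta_mul Θ j, delta_star Θ j⟩

theorem U_mem_smooth {n : ℕ} (Θ : Matrix (Fin n) (Fin n) ℝ) (j : Fin n) :
    U Θ j ∈ smoothSubalgebra Θ := by
  change ContDiff ℝ ∞ _
  simp only [action_U]
  have h : ContDiff ℝ ∞ fun s : Fin n → ℝ => ((s j : ℝ) : ℂ) :=
    Complex.ofRealCLM.contDiff.comp (contDiff_apply ℝ ℝ j)
  exact (contDiff_const.mul h).cexp.smul contDiff_const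

theorem delta_U {n : ℕ} (Θ : Matrix (Fin n) (Fin n) ℝ) (j k : Fin n) :
    delta Θ j ⟨U Θ k, U_mem_smooth Θ k⟩ =
      (if j = k then 2 * Real.pi * Complex.I else 0 : ℂ) • ⟨U Θ k, U_mem_smooth Θ k⟩ := by
  apply Subtype.ext
  have h : HasFDerivAt (fun s : Fin n → ℝ => Complex.exp (Complex.I * s k) • U Θ k)
      (((Complex.I • (Complex.ofRealCLM.comp (ContinuousLinearMap.proj k :
        (Fin n → ℝ) →L[ℝ] ℝ)))).smulRight (U Θ k)) 0 := by
    have h1 : HasFDerivAt (fun s : Fin n → ℝ => Complex.I * ((s k : ℝ) : ℂ))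
        (Complex.I • (Complex.ofRealCLM.comp (ContinuousLinearMap.proj k :
          (Fin n → ℝ) →L[ℝ] ℝ))) 0 :=
      (Complex.ofRealCLM.comp (ContinuousLinearMap.proj k :
          (Fin n → ℝ) →L[ℝ] ℝ)).hasFDerivAt.const_mul Complex.I
    have h2 := h1.cexp.smul_const (U Θ k)
    simpa using h2
  rw [coe_delta]
  simp only [action_U, h.fderiv]
  by_cases hjk : j = k
  · subst hjk
    simp [smul_smul]
  · simp [hjk, Ne.symm hjk]

/-! ### Exponentials of smooth elements -/

theorem exp_mem_smooth {n : ℕ} {Θ : Matrix (Fin n) (Fin n) ℝ} (f : Smooth Θ) :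
    NormedSpace.exp (f : Torus Θ) ∈ smoothSubalgebra Θ := by
  change ContDiff ℝ ∞ fun s => action Θ s (NormedSpace.exp (f : Torus Θ))
  have h : (fun s => action Θ s (NormedSpace.exp (f : Torus Θ))) =
      fun s => NormedSpace.exp (action Θ s (f : Torus Θ)) := by
    ext1 s
    let _ : NormedAlgebra ℚ (Torus Θ) := NormedAlgebra.restrictScalars ℚ ℂ (Torus Θ)
    exact NormedSpace.map_exp (action Θ s) (continuous_action Θ s) (f : Torus Θ)
  rw [h]
  have h2 : ContDiff ℝ ∞ (NormedSpace.exp : Torus Θ → Torus Θ) :=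
    contDiff_iff_contDiffAt.2 fun x => (NormedSpace.exp_analytic (𝕂 := ℝ) x).contDiffAt
  exact h2.comp (contDiff_action f)

/-- The exponential `e^f` in `A_Θ^∞`. -/
def expS {n : ℕ} {Θ : Matrix (Fin n) (Fin n) ℝ} (f : Smooth Θ) : Smooth Θ :=
  ⟨NormedSpace.exp (f : Torus Θ), exp_mem_smooth f⟩

/-! ### Riemannian metrics, connections and curvature -/

/-- The free left `A_Θ^∞`-module `𝒳_Θ` on the canonical derivations `∂_1, …, ∂_n`. -/
abbrev VectorFields {n : ℕ} (Θ : Matrix (Fin n) (Fin n) ℝ) : Type := Fin n → Smooth Θ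

/-- The basis element `∂_j` of `𝒳_Θ`. -/
def partialVec {n : ℕ} (Θ : Matrix (Fin n) (Fin n) ℝ) (j : Fin n) : VectorFields Θ :=
  Pi.single j 1

/-- A Riemannian metric on `𝒳_Θ`. -/
structure RiemannianMetric {n : ℕ} (Θ : Matrix (Fin n) (Fin n) ℝ) where
  pairing : VectorFields Θ → VectorFields Θ → Smooth Θ
  add_left : ∀ X Y Z, pairing (X + Y) Z = pairing X Z + pairing Y Z
  smul_left : ∀ (a : Smooth Θ) (X Y), pairing (a • X) Y = a * pairing X Y
  hermitian : ∀ X Y, pairing X Y = star (pairing Y X)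
  nonneg : ∀ X, 0 ≤ (pairing X X : Torus Θ)
  definite : ∀ X, pairing X X = 0 → X = 0
  real : ∀ i j, pairing (partialVec Θ i) (partialVec Θ j) =
    pairing (partialVec Θ j) (partialVec Θ i)

theorem expS_nonneg {n : ℕ} {Θ : Matrix (Fin n) (Fin n) ℝ} (f : Smooth Θ)
    (hf : IsSelfAdjoint f) :
    IsSelfAdjoint (expS f) ∧ ∃ k l : Torus Θ, IsSelfAdjoint k ∧ k * l = 1 ∧
      (expS f : Torus Θ) = k * k := by
  let _ : NormedAlgebra ℚ (Torus Θ) := NormedAlgebra.restrictScalars ℚ ℂ (Torus Θ)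
  have hf' : IsSelfAdjoint (f : Torus Θ) := congrArg Subtype.val hf
  have hq : IsSelfAdjoint ((2⁻¹ : ℝ) • (f : Torus Θ)) := by
    rw [IsSelfAdjoint, star_smul, hf'.star_eq]
    simp
  refine ⟨Subtype.ext hf'.exp, NormedSpace.exp ((2⁻¹ : ℝ) • (f : Torus Θ)),
    NormedSpace.exp (-((2⁻¹ : ℝ) • (f : Torus Θ))), hq.exp, ?_, ?_⟩
  · rw [← NormedSpace.exp_add_of_commute (Commute.neg_right (Commute.refl _)), add_neg_cancel,
      NormedSpace.exp_zero]
  · rw [← NormedSpace.exp_add_of_commute (Commute.refl _), ← add_smul]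
    norm_num [expS]

/-- The conformally flat metric `⟨∂_i, ∂_j⟩ = e^f δ_{ij}`. -/
def conformalMetric {n : ℕ} {Θ : Matrix (Fin n) (Fin n) ℝ} (f : Smooth Θ)
    (hf : IsSelfAdjoint f) : RiemannianMetric Θ where
  pairing X Y := ∑ i, X i * expS f * star (Y i)
  add_left X Y Z := by simp [add_mul, Finset.sum_add_distrib]
  smul_left a X Y := by simp [Finset.mul_sum, mul_assoc]
  hermitian X Y := by simp [(expS_nonneg f hf).1.star_eq, mul_assoc]
  nonneg X := by
    obtain ⟨k, l, hk, -, h⟩ := (expS_nonneg f hf).2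
    simp only [AddSubmonoidClass.coe_finsetSum, MulMemClass.coe_mul, StarMemClass.coe_star, h]
    refine Finset.sum_nonneg fun i _ => ?_
    have := mul_star_self_nonneg ((X i : Torus Θ) * k)
    simpa [hk.star_eq, mul_assoc] using this
  definite X hX := by
    obtain ⟨k, l, hk, hkl, h⟩ := (expS_nonneg f hf).2
    have h1 : ∑ i, ((X i : Torus Θ) * k) * star ((X i : Torus Θ) * k) = 0 := by
      have := congrArg (Subtype.val : Smooth Θ → Torus Θ) hX
      simpa [hk.star_eq, mul_assoc, h] using this
    rw [Finset.sum_eq_zero_iff_of_nonneg fun i _ => mul_star_self_nonneg _] at h1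
    funext i
    have h2 := CStarRing.mul_star_self_eq_zero_iff _ |>.1 (h1 i (Finset.mem_univ i))
    have h3 : (X i : Torus Θ) = (X i : Torus Θ) * k * l := by rw [mul_assoc, hkl, mul_one]
    rw [h2, zero_mul] at h3
    exact Subtype.ext h3
  real i j := by
    rcases eq_or_ne i j with rfl | h
    · rfl
    · rw [Finset.sum_eq_zero, Finset.sum_eq_zero]
      · intro x _
        by_cases hx : x = j
        · subst hx
          simp [partialVec, h.symm]
        · simp [partialVec, Pi.single_apply, hx]
      · intro x _
        by_cases hx : x = j
        · subst hx
          simp [partialVec, h.symm]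
        · simp [partialVec, Pi.single_apply, hx]

theorem conformalMetric_partialVec {n : ℕ} {Θ : Matrix (Fin n) (Fin n) ℝ} (f : Smooth Θ)
    (hf : IsSelfAdjoint f) (i j : Fin n) :
    (conformalMetric f hf).pairing (partialVec Θ i) (partialVec Θ j) =
      if i = j then expS f else 0 := by
  simp only [conformalMetric, partialVec, Pi.single_apply]
  rw [Finset.sum_eq_single j]
  · by_cases h : i = j
    · simp [h]
    · simp [h, Ne.symm h]
  · intro x _ hx
    simp [hx]
  · simp

/-- A connection `∇ : 𝒟_Θ × 𝒳_Θ → 𝒳_Θ`: linear in the derivation and satisfying the Leibniz rule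
in the vector field. The normalisation `∇_{ad a} = a` along inner derivations, which is consistent
only when `A_Θ` has trivial centre and does not affect `∇` along the `∂_i`, is not required. -/
structure Connection {n : ℕ} (Θ : Matrix (Fin n) (Fin n) ℝ) where
  cov : starDerivations Θ →ₗ[ℝ] Module.End ℂ (VectorFields Θ)
  leibniz : ∀ (Z : starDerivations Θ) (a : Smooth Θ) (X : VectorFields Θ),
    cov Z (a • X) = (Z : Module.End ℂ (Smooth Θ)) a • X + a • cov Z X

/-- The metric connections with self-adjoint Christoffel symbols and no torsion. -/
structure Connection.IsLeviCivita {n : ℕ} {Θ : Matrix (Fin n) (Fin n) ℝ} (D : Connection Θ)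
    (g : RiemannianMetric Θ) : Prop where
  compatible : ∀ (Z : starDerivations Θ) (X Y : VectorFields Θ),
    (Z : Module.End ℂ (Smooth Θ)) (g.pairing X Y) =
      g.pairing (D.cov Z X) Y + g.pairing X (D.cov Z Y)
  torsion_free : ∀ i j,
    D.cov (partialDer Θ i) (partialVec Θ j) = D.cov (partialDer Θ j) (partialVec Θ i)
  real : ∀ i j k, IsSelfAdjoint
    (g.pairing (D.cov (partialDer Θ i) (partialVec Θ j)) (partialVec Θ k))

/-- The curvature `R(Z, W) = ∇_W ∇_Z - ∇_Z ∇_W + ∇_{[Z, W]}`. -/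
def Connection.curvature {n : ℕ} {Θ : Matrix (Fin n) (Fin n) ℝ} (D : Connection Θ)
    (Z W : starDerivations Θ) : Module.End ℂ (VectorFields Θ) :=
  D.cov W * D.cov Z - D.cov Z * D.cov W + D.cov ⁅Z, W⁆

/-- `R_{ijkl} = ⟨R(∂_i, ∂_j) ∂_k, ∂_l⟩`. -/
def Connection.riemann {n : ℕ} {Θ : Matrix (Fin n) (Fin n) ℝ} (D : Connection Θ)
    (g : RiemannianMetric Θ) (i j k l : Fin n) : Smooth Θ :=
  g.pairing (D.curvature (partialDer Θ i) (partialDer Θ j) (partialVec Θ k)) (partialVec Θ l)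

/-- The inverse `(g^{ij})` of the matrix `g_{ij} = ⟨∂_i, ∂_j⟩`. -/
def RiemannianMetric.inverse {n : ℕ} {Θ : Matrix (Fin n) (Fin n) ℝ} (g : RiemannianMetric Θ) :
    Matrix (Fin n) (Fin n) (Smooth Θ) :=
  Ring.inverse (Matrix.of fun i j => g.pairing (partialVec Θ i) (partialVec Θ j))

/-- The Ricci curvature `R_{ik} = ∑ g^{jl} R_{ijkl}`; indices are raised by multiplication
on the left. -/
def Connection.ricci {n : ℕ} {Θ : Matrix (Fin n) (Fin n) ℝ} (D : Connection Θ)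
    (g : RiemannianMetric Θ) (i k : Fin n) : Smooth Θ :=
  ∑ j, ∑ l, g.inverse j l * D.riemann g i j k l

/-- The scalar curvature `R = ∑ g^{ik} R_{ik}`. -/
def Connection.scalarCurvature {n : ℕ} {Θ : Matrix (Fin n) (Fin n) ℝ} (D : Connection Θ)
    (g : RiemannianMetric Θ) : Smooth Θ :=
  ∑ i, ∑ k, g.inverse i k * D.ricci g i k

/-! ### Functions of the modular derivation -/

/-- The modular derivation `∇ = -ad_f`, that is `∇ x = -(f x - x f)`. -/
def modularDerivation {n : ℕ} {Θ : Matrix (Fin n) (Fin n) ℝ} (f : Torus Θ) :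
    Module.End ℂ (Torus Θ) :=
  -(LinearMap.mulLeft ℂ f - LinearMap.mulRight ℂ f)

/-- The terms of the series `F(T) x = ∑ m, (F⁽ᵐ⁾(0) / m!) Tᵐ x`, for an entire function `F`. -/
def calcTerm {V : Type} [AddCommGroup V] [Module ℂ V] (F : ℂ → ℂ) (T : Module.End ℂ V) (x : V)
    (m : ℕ) : V :=
  (iteratedDeriv m F 0 / (m ! : ℂ)) • (T ^ m) x

/-- `F(∇) x`. -/
def calc₁ {n : ℕ} {Θ : Matrix (Fin n) (Fin n) ℝ} (F : ℂ → ℂ) (T : Module.End ℂ (Torus Θ))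
    (x : Torus Θ) : Torus Θ :=
  ∑' m, calcTerm F T x m

/-- The terms of the series `F(T, T)(x y) = ∑ (∂_sᵐ ∂_tᵏ F (0, 0) / (m! k!)) (Tᵐ x) (Tᵏ y)`,
for an entire function `F(s, t)`: the first variable acts on the first factor and the second
variable on the second factor. -/
def calcTerm₂ {V : Type} [Ring V] [Algebra ℂ V] (F : ℂ × ℂ → ℂ) (T : Module.End ℂ V) (x y : V)
    (p : ℕ × ℕ) : V :=
  (iteratedDeriv p.1 (fun s => iteratedDeriv p.2 (fun t => F (s, t)) 0) 0 /
    ((p.1 ! : ℂ) * (p.2 ! : ℂ))) • ((T ^ p.1) x * (T ^ p.2) y)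

/-- `F(∇, ∇)(x y)`. -/
def calc₂ {n : ℕ} {Θ : Matrix (Fin n) (Fin n) ℝ} (F : ℂ × ℂ → ℂ) (T : Module.End ℂ (Torus Θ))
    (x y : Torus Θ) : Torus Θ :=
  ∑' p : ℕ × ℕ, calcTerm₂ F T x y p

/-- The entire function `K(s) = (e^s - 1) / s`; the singularity at `0` is removed by
continuity. -/
def K : ℂ → ℂ := extendFrom {s | s ≠ 0} fun s => (Complex.exp s - 1) / s

/-- The entire function
`H(s, t) = (s (e^t - 1) (-3 e^s - 1) + t (e^s - 1) (e^t + 3)) / (2 s t (s + t))`;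
the singularities on `s t (s + t) = 0` are removed by continuity. -/
def H : ℂ × ℂ → ℂ := extendFrom {p | p.1 * p.2 * (p.1 + p.2) ≠ 0} fun p =>
  (p.1 * (Complex.exp p.2 - 1) * (-3 * Complex.exp p.1 - 1) +
    p.2 * (Complex.exp p.1 - 1) * (Complex.exp p.2 + 3)) / (2 * p.1 * p.2 * (p.1 + p.2))

end NCTorus

end

open scoped Nat ContDiff

noncomputable section

namespace NCTorus

open Filter Topology

attribute [local instance] LieRing.ofAssociativeRing LieAlgebra.ofAssociativeAlgebra

section BanachAlgebra

/-! ### Power series -/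

/-! Write `d_i = δ_i(e^f)` and `c_ijk = ⟨D_{∂_i} ∂_j, ∂_k⟩`. Since the `c_ijk` are self-adjoint,
metric compatibility reads `c_ijk + c_ikj = δ_jk d_i`; together with the symmetry in `i, j` the
Koszul argument forces `c_ijk = ½(δ_jk d_i + δ_ik d_j - δ_ij d_k)` (`IsLeviCivita.christoffel`).
Compatibility also expresses the curvature through the `c_ijk` and their first derivatives
(`IsLeviCivita.riemann`), and contraction in dimension four gives the first formula. Conversely
these symbols, extended to all `*`-derivations, define a Levi-Civita connection
(`exists_isLeviCivita`).

For the second formula let `x = δ_i f` and let `y(v) = e^{-vf} δ_i(e^{vf})`, `z(v) = e^{-vf}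
δ_i²(e^{vf})`. Conjugation by `e^{vf}` is `e^{v∇}`, so `y' = e^{v∇} x` and `z' = e^{v∇}(δ_i² f) + 2
e^{v∇}(x) y`. Termwise integration over `[0, 1]` gives `e^{-f} δ_i(e^f) = K(∇) x` and `e^{-f}
δ_i²(e^f) = K(∇)(δ_i² f) + 2 q(∇, ∇)(x x)`, where `q(s, t) = ∫₀¹ e^{vs} (e^{vt} - 1)/t dv`
(`logDeriv_hasSum`, `logDeriv₂_hasSum`). Inserting this in the first formula leaves the quadratic
term `3 e^{-f} (½ K(s) K(t) - 2 q(s, t))`, and the bracket is `H(s, t)` (`hasSum_hCoeff`). -/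

theorem iteratedDeriv_zero_of_hasSum {F : ℂ → ℂ} {a : ℕ → ℂ}
    (h : ∀ z, HasSum (fun n => a n * z ^ n) (F z)) (n : ℕ) :
    iteratedDeriv n F 0 = (n ! : ℂ) * a n := by
  have h1 : HasFPowerSeriesAt F (FormalMultilinearSeries.ofScalars ℂ a) 0 := by
    rw [hasFPowerSeriesAt_iff]
    refine Eventually.of_forall fun z => ?_
    simpa [FormalMultilinearSeries.coeff_ofScalars, mul_comm] using h z
  have h2 := h1.eq_formalMultilinearSeries h1.analyticAt.hasFPowerSeriesAt
  have h3 := congrFun ((FormalMultilinearSeries.ofScalars_series_eq_iff (E := ℂ) _ _).1 h2) n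
  have h4 : (n ! : ℂ) ≠ 0 := by exact_mod_cast n.factorial_ne_zero
  rw [h3]
  field_simp

theorem hasSum_prod_mul {a b : ℕ → ℂ} (ha : Summable fun m => ‖a m‖)
    (hb : Summable fun m => ‖b m‖) {α β : ℂ} (hα : HasSum a α) (hβ : HasSum b β) :
    HasSum (fun p : ℕ × ℕ => a p.1 * b p.2) (α * β) :=
  hα.mul hβ (summable_mul_of_summable_norm ha hb)

variable {A : Type*} [NormedRing A] [NormedAlgebra ℂ A]

/-- The bounded inner derivation `x ↦ x f - f x`. -/
def innerDer (f : A) : A →L[ℂ] A :=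
  (ContinuousLinearMap.mul ℂ A).flip f - ContinuousLinearMap.mul ℂ A f

@[simp] theorem innerDer_apply (f x : A) : innerDer f x = x * f - f * x := rfl

theorem summable_norm_pow_div_factorial (T : A →L[ℂ] A) (x : A) :
    Summable fun n : ℕ => ‖(n ! : ℂ)⁻¹ • (T ^ n) x‖ := by
  refine Summable.of_nonneg_of_le (fun _ => norm_nonneg _) (fun n => ?_)
    ((Real.summable_pow_div_factorial ‖T‖).mul_right ‖x‖)
  have h : ‖(T ^ n) x‖ ≤ ‖T‖ ^ n * ‖x‖ := by
    induction n with
    | zero => simp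
    | succ n ih =>
      rw [pow_succ']
      refine (T.le_opNorm _).trans ?_
      rw [pow_succ', mul_assoc]
      exact mul_le_mul_of_nonneg_left ih (norm_nonneg _)
  rw [norm_smul, norm_inv, Complex.norm_natCast, div_mul_eq_mul_div, div_eq_inv_mul]
  gcongr

theorem summable_norm_pow_div_factorial_succ (T : A →L[ℂ] A) (x : A) :
    Summable fun n : ℕ => ‖((n + 1)! : ℂ)⁻¹ • (T ^ n) x‖ := by
  refine Summable.of_nonneg_of_le (fun _ => norm_nonneg _) (fun n => ?_)
    (summable_norm_pow_div_factorial T x)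
  rw [norm_smul, norm_smul, norm_inv, norm_inv, Complex.norm_natCast, Complex.norm_natCast]
  have : (n ! : ℝ) ≤ ((n + 1)! : ℝ) := by exact_mod_cast Nat.factorial_le n.le_succ
  gcongr

variable [CompleteSpace A]

/-- Termwise integration, on the unit interval, of a series of monomials. -/
theorem hasSum_primitive {ι : Type*} [Countable ι] (e : ι → ℕ) (c : ι → A)
    (hc : Summable fun i => ‖c i‖) {F F' : ℝ → A} (hF0 : F 0 = 0)
    (hF : ∀ v, HasDerivAt F (F' v) v) (hF' : Continuous F')
    (hs : ∀ r ∈ Set.Icc (0 : ℝ) 1, HasSum (fun i => (r : ℂ) ^ e i • c i) (F' r))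
    {v : ℝ} (hv : v ∈ Set.Icc (0 : ℝ) 1) :
    HasSum (fun i => ((v : ℂ) ^ (e i + 1) / ((e i : ℂ) + 1)) • c i) (F v) := by
  have hsub : ∀ r ∈ Set.uIoc 0 v, r ∈ Set.Icc (0 : ℝ) 1 := by
    intro r hr
    rw [Set.uIoc_of_le hv.1] at hr
    exact ⟨hr.1.le, hr.2.trans hv.2⟩
  have key := intervalIntegral.hasSum_integral_of_dominated_convergence (a := 0) (b := v)
    (μ := MeasureTheory.volume) (F := fun i (r : ℝ) => (r : ℂ) ^ e i • c i) (f := F')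
    (fun i _ => ‖c i‖)
    (fun i => Continuous.aestronglyMeasurable (by fun_prop))
    (fun i => Eventually.of_forall fun r hr => by
      have := hsub r hr
      rw [norm_smul, norm_pow, Complex.norm_real, Real.norm_of_nonneg this.1]
      exact mul_le_of_le_one_left (norm_nonneg _) (pow_le_one₀ this.1 this.2))
    (Eventually.of_forall fun _ _ => hc)
    intervalIntegrable_const
    (Eventually.of_forall fun r hr => hs r (hsub r hr))
  rw [intervalIntegral.integral_eq_sub_of_hasDerivAt (fun r _ => hF r)
    (hF'.intervalIntegrable _ _), hF0, sub_zero] at key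
  refine key.congr_fun fun i => ?_
  have h1 : ∀ r : ℝ, HasDerivAt (fun r : ℝ => ((r : ℂ) ^ (e i + 1) / ((e i : ℂ) + 1)) • c i)
      ((r : ℂ) ^ e i • c i) r := by
    intro r
    have h0 : ((e i : ℂ) + 1) ≠ 0 := by exact_mod_cast (e i).succ_ne_zero
    have := ((((hasDerivAt_id r).ofReal_comp).fun_pow (e i + 1)).div_const
      ((e i : ℂ) + 1)).smul_const (c i)
    refine this.congr_deriv ?_
    simp [mul_div_cancel_left₀ _ h0]
  rw [intervalIntegral.integral_eq_sub_of_hasDerivAt (fun r _ => h1 r)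
    (Continuous.intervalIntegrable (by fun_prop) _ _)]
  simp

/-- Termwise integration of a product of two series and a single series, on `[0, 1]`. -/
theorem hasSum_primitive_mul {a b d : ℕ → A} (ha : Summable fun n => ‖a n‖)
    (hb : Summable fun n => ‖b n‖) (hd : Summable fun n => ‖d n‖) {F α β γ : ℝ → A}
    (hα : ∀ r ∈ Set.Icc (0 : ℝ) 1, HasSum (fun n => (r : ℂ) ^ n • a n) (α r))
    (hβ : ∀ r ∈ Set.Icc (0 : ℝ) 1, HasSum (fun n => (r : ℂ) ^ (n + 1) • b n) (β r))
    (hγ : ∀ r ∈ Set.Icc (0 : ℝ) 1, HasSum (fun n => (r : ℂ) ^ n • d n) (γ r))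
    (hαc : Continuous α) (hβc : Continuous β) (hγc : Continuous γ)
    (hF0 : F 0 = 0) (hF : ∀ v, HasDerivAt F (γ v + (2 : ℂ) • (α v * β v)) v) :
    ∃ S Q : A, HasSum (fun n : ℕ => ((n : ℂ) + 1)⁻¹ • d n) S ∧
      HasSum (fun p : ℕ × ℕ => ((p.1 : ℂ) + p.2 + 2)⁻¹ • (a p.1 * b p.2)) Q ∧
      F 1 = S + (2 : ℂ) • Q := by
  -- Over the disjoint union of the two index sets the integrand is one series of monomials. The
  -- series of `β` starts in degree one, hence the exponent `p.1 + p.2 + 1`, which integration turns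
  -- into the factor `1 / (p.1 + p.2 + 2)`.
  let c : ℕ ⊕ (ℕ × ℕ) → A := Sum.elim d fun p => (2 : ℂ) • (a p.1 * b p.2)
  let e : ℕ ⊕ (ℕ × ℕ) → ℕ := Sum.elim (fun n => n) fun p => p.1 + p.2 + 1
  have hc : Summable fun i => ‖c i‖ := by
    refine Summable.sum _ hd ?_
    simpa [c, Function.comp_def, norm_smul] using (ha.mul_norm hb).mul_left 2
  have hs : ∀ r ∈ Set.Icc (0 : ℝ) 1, HasSum (fun i => (r : ℂ) ^ e i • c i)
      (γ r + (2 : ℂ) • (α r * β r)) := by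
    intro r hr
    refine HasSum.sum (hγ r hr) ?_
    have hle : ∀ (n : ℕ) (z : A), ‖(r : ℂ) ^ n • z‖ ≤ ‖z‖ := fun n z => by
      rw [norm_smul, norm_pow, Complex.norm_real, Real.norm_of_nonneg hr.1]
      exact mul_le_of_le_one_left (norm_nonneg _) (pow_le_one₀ hr.1 hr.2)
    have hra : Summable fun n : ℕ => ‖(r : ℂ) ^ n • a n‖ :=
      Summable.of_nonneg_of_le (fun _ => norm_nonneg _) (fun n => hle n _) ha
    have hrb : Summable fun n : ℕ => ‖(r : ℂ) ^ (n + 1) • b n‖ :=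
      Summable.of_nonneg_of_le (fun _ => norm_nonneg _) (fun n => hle (n + 1) _) hb
    have hm : Summable fun p : ℕ × ℕ => ((r : ℂ) ^ p.1 • a p.1) * ((r : ℂ) ^ (p.2 + 1) • b p.2) :=
      summable_mul_of_summable_norm (f := fun n : ℕ => (r : ℂ) ^ n • a n)
        (g := fun n : ℕ => (r : ℂ) ^ (n + 1) • b n) hra hrb
    have hp := HasSum.mul (f := fun n : ℕ => (r : ℂ) ^ n • a n)
      (g := fun n : ℕ => (r : ℂ) ^ (n + 1) • b n) (hα r hr) (hβ r hr) hm
    have h := hp.const_smul (2 : ℂ)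
    refine h.congr_fun fun p => ?_
    simp only [Function.comp_apply, e, c, Sum.elim_inr, smul_mul_assoc, mul_smul_comm, smul_smul]
    congr 1
    ring
  have key := hasSum_primitive e c hc hF0 hF (hγc.add ((hαc.mul hβc).const_smul _)) hs
    (v := 1) ⟨zero_le_one, le_rfl⟩
  have hle : ∀ (n : ℕ) (z : A), ‖((n : ℂ) + 1)⁻¹ • z‖ ≤ ‖z‖ := fun n z => by
    rw [norm_smul, norm_inv, ← Nat.cast_succ, Complex.norm_natCast]
    exact mul_le_of_le_one_left (norm_nonneg _)
      (inv_le_one_of_one_le₀ (by exact_mod_cast Nat.succ_pos _))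
  have hS : Summable fun n : ℕ => ((n : ℂ) + 1)⁻¹ • d n :=
    Summable.of_norm_bounded hd fun n => hle n _
  have hQ : Summable fun p : ℕ × ℕ => ((p.1 : ℂ) + p.2 + 2)⁻¹ • (a p.1 * b p.2) := by
    refine Summable.of_norm_bounded (ha.mul_norm hb) fun p => ?_
    rw [show (p.1 : ℂ) + p.2 + 2 = ((p.1 + p.2 + 1 : ℕ) : ℂ) + 1 by push_cast; ring]
    exact hle (p.1 + p.2 + 1) (a p.1 * b p.2)
  refine ⟨_, _, hS.hasSum, hQ.hasSum, ?_⟩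
  have h3 := HasSum.sum (f := Sum.elim (fun n : ℕ => ((n : ℂ) + 1)⁻¹ • d n) fun p : ℕ × ℕ =>
      (2 : ℂ) • (((p.1 : ℂ) + p.2 + 2)⁻¹ • (a p.1 * b p.2))) hS.hasSum
    (hQ.hasSum.const_smul (2 : ℂ))
  refine HasSum.unique ?_ h3
  simp only [Complex.ofReal_one, one_pow, one_div] at key
  refine key.congr_fun fun i => ?_
  rcases i with n | p
  · rfl
  · simp only [c, e, Sum.elim_inr]
    rw [smul_comm]
    congr 2
    push_cast
    ring

/-! ### Conjugation by exponentials -/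

theorem exp_clm_hasSum (M : A →L[ℂ] A) (x : A) :
    HasSum (fun n : ℕ => (n ! : ℂ)⁻¹ • (M ^ n) x) (NormedSpace.exp M x) :=
  (NormedSpace.exp_series_hasSum_exp' (𝕂 := ℂ) M).mapL (ContinuousLinearMap.apply ℂ A x)

theorem exp_mulLeft_apply (a x : A) :
    NormedSpace.exp (ContinuousLinearMap.mul ℂ A a) x = NormedSpace.exp a * x := by
  refine (exp_clm_hasSum _ x).unique ?_
  refine ((NormedSpace.exp_series_hasSum_exp' (𝕂 := ℂ) a).mul_right x).congr_fun fun n => ?_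
  rw [smul_mul_assoc]
  congr 1
  induction n with
  | zero => simp
  | succ n ih => simp [pow_succ', ih, mul_assoc]

theorem exp_mulRight_apply (a x : A) :
    NormedSpace.exp ((ContinuousLinearMap.mul ℂ A).flip a) x = x * NormedSpace.exp a := by
  refine (exp_clm_hasSum _ x).unique ?_
  refine ((NormedSpace.exp_series_hasSum_exp' (𝕂 := ℂ) a).mul_left x).congr_fun fun n => ?_
  rw [mul_smul_comm]
  congr 1
  induction n with
  | zero => simp
  | succ n ih => rw [pow_succ', pow_succ]; simp [ih, mul_assoc]

/-- Right multiplication by `f` and left multiplication by `-f` commute, so the exponential of their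
sum factors. -/
theorem exp_innerDer_apply (f x : A) :
    NormedSpace.exp (innerDer f) x = NormedSpace.exp (-f) * x * NormedSpace.exp f := by
  let _ : NormedAlgebra ℚ (A →L[ℂ] A) := NormedAlgebra.restrictScalars ℚ ℂ (A →L[ℂ] A)
  have h : innerDer f =
      (ContinuousLinearMap.mul ℂ A).flip f + ContinuousLinearMap.mul ℂ A (-f) := by
    rw [innerDer, map_neg, sub_eq_add_neg]
  have hc : Commute ((ContinuousLinearMap.mul ℂ A).flip f) (ContinuousLinearMap.mul ℂ A (-f)) := by
    ext y
    simp [mul_assoc]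
  rw [h, NormedSpace.exp_add_of_commute hc]
  change NormedSpace.exp ((ContinuousLinearMap.mul ℂ A).flip f)
    (NormedSpace.exp (ContinuousLinearMap.mul ℂ A (-f)) x) = _
  rw [exp_mulLeft_apply, exp_mulRight_apply]

theorem exp_conj_hasSum (f x : A) (c : ℂ) :
    HasSum (fun n : ℕ => c ^ n • ((n ! : ℂ)⁻¹ • (innerDer f ^ n) x))
      (NormedSpace.exp (-(c • f)) * x * NormedSpace.exp (c • f)) := by
  rw [← exp_innerDer_apply]
  have h : innerDer (c • f) = c • innerDer f := by
    ext y
    simp [smul_sub]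
  refine (exp_clm_hasSum (innerDer (c • f)) x).congr_fun fun n => ?_
  rw [smul_comm]
  congr 1
  induction n with
  | zero => simp
  | succ n ih => 
    rw [pow_succ', pow_succ', pow_succ', show ∀ S R : A →L[ℂ] A, (S * R) x = S (R x) from fun _ _ => rfl,
      show ∀ S R : A →L[ℂ] A, (S * R) x = S (R x) from fun _ _ => rfl, ← ih, h, smul_apply, map_smul, mul_smul]

theorem hasDerivAt_exp_ofReal_smul (f : A) (v : ℝ) :
    HasDerivAt (fun v : ℝ => NormedSpace.exp ((v : ℂ) • f))
      (NormedSpace.exp ((v : ℂ) • f) * f) v := by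
  have h := (hasDerivAt_exp_smul_const (𝕂 := ℂ) f (v : ℂ)).scomp (𝕜 := ℝ) v
    (hasDerivAt_id v).ofReal_comp
  simp only [Function.comp_def, Complex.ofReal_one, one_smul] at h
  exact h

theorem continuous_exp_ofReal_smul (f : A) :
    Continuous fun v : ℝ => NormedSpace.exp ((v : ℂ) • f) :=
  continuous_iff_continuousAt.2 fun v => (hasDerivAt_exp_ofReal_smul f v).continuousAt

theorem exp_ofReal_smul_add (f : A) (u v : ℝ) :
    NormedSpace.exp (((u + v : ℝ) : ℂ) • f) =
      NormedSpace.exp ((u : ℂ) • f) * NormedSpace.exp ((v : ℂ) • f) := by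
  let _ : NormedAlgebra ℚ A := NormedAlgebra.restrictScalars ℚ ℂ A
  rw [← NormedSpace.exp_add_of_commute
    (((Commute.refl f).smul_left _).smul_right _), ← add_smul, Complex.ofReal_add]

theorem exp_neg_mul_exp (f : A) : NormedSpace.exp (-f) * NormedSpace.exp f = 1 := by
  let _ : NormedAlgebra ℚ A := NormedAlgebra.restrictScalars ℚ ℂ A
  rw [← NormedSpace.exp_add_of_commute (Commute.neg_left (Commute.refl _)), neg_add_cancel,
    NormedSpace.exp_zero]

/-! ### First and second logarithmic derivatives of one-parameter groups -/

/-- If `w` satisfies, up to the correction `C`, the Leibniz rule along `u ↦ exp (u f)`, then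
`v ↦ exp (-v f) w v` is differentiable. -/
theorem hasDerivAt_logDeriv {f x : A} {w c : ℝ → A} {C : ℝ → ℝ → A} (hw0 : w 0 = 0)
    (hw : HasDerivAt w x 0) (hC0 : ∀ v, C 0 v = 0) (hC : ∀ v, HasDerivAt (fun u => C u v) (c v) 0)
    (hadd : ∀ u v : ℝ, w (u + v) = w u * NormedSpace.exp ((v : ℂ) • f) + C u v +
      NormedSpace.exp ((u : ℂ) • f) * w v) (v : ℝ) :
    HasDerivAt (fun v : ℝ => NormedSpace.exp (-((v : ℂ) • f)) * w v)
      (NormedSpace.exp (-((v : ℂ) • f)) * x * NormedSpace.exp ((v : ℂ) • f) +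
        NormedSpace.exp (-((v : ℂ) • f)) * c v) v := by
  -- At `0` the derivative of the exponential factor is multiplied by `w 0 = 0` and drops out.
  have hE : ∀ {w : ℝ → A} {x : A}, w 0 = 0 → HasDerivAt w x 0 →
      HasDerivAt (fun u : ℝ => NormedSpace.exp (-((u : ℂ) • f)) * w u) x 0 := by
    intro w x hw0 hw
    have h := (hasDerivAt_exp_ofReal_smul (-f) 0).fun_mul hw
    simpa [hw0] using h
  have h1 := hE hw0 hw
  have h1' := hE (hC0 v) (hC v)
  -- Splitting `u = (u - v) + v` in the Leibniz rule transports differentiability from `0` to `v`: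
  -- only functions of `u - v`, multiplied by constants, remain.
  have h2 : ∀ u : ℝ, NormedSpace.exp (-((u : ℂ) • f)) * w u =
      NormedSpace.exp (-((v : ℂ) • f)) * (NormedSpace.exp (-(((u - v : ℝ) : ℂ) • f)) * w (u - v)) *
        NormedSpace.exp ((v : ℂ) • f) +
      NormedSpace.exp (-((v : ℂ) • f)) * (NormedSpace.exp (-(((u - v : ℝ) : ℂ) • f)) * C (u - v) v) +
      NormedSpace.exp (-((v : ℂ) • f)) * w v := by
    intro u
    have h3 := hadd (u - v) v
    have h4 := exp_ofReal_smul_add (-f) v (u - v)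
    rw [sub_add_cancel] at h3
    rw [add_sub_cancel] at h4
    simp only [smul_neg] at h4
    have h5 := exp_neg_mul_exp (((u - v : ℝ) : ℂ) • f)
    rw [h3, h4, mul_add, mul_add]
    simp only [mul_assoc]
    rw [← mul_assoc (NormedSpace.exp (-(((u - v : ℝ) : ℂ) • f)))
      (NormedSpace.exp (((u - v : ℝ) : ℂ) • f)), h5, one_mul]
  have hT : ∀ {w : ℝ → A} {x : A},
      HasDerivAt (fun u : ℝ => NormedSpace.exp (-((u : ℂ) • f)) * w u) x 0 →
      HasDerivAt (fun u : ℝ => NormedSpace.exp (-(((u - v : ℝ) : ℂ) • f)) * w (u - v)) x v := by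
    intro w x h
    rw [← sub_self v] at h
    exact h.comp_sub_const v v
  rw [funext h2]
  exact ((((hT h1).const_mul _).mul_const _).add ((hT h1').const_mul _)).add_const _

/-- The Taylor coefficients of the second-order part of the exponential. -/
def qCoeff (p : ℕ × ℕ) : ℂ := ((p.1 : ℂ) + p.2 + 2)⁻¹ * ((p.1 ! : ℂ)⁻¹ * ((p.2 + 1)! : ℂ)⁻¹)

theorem hasDerivAt_logDeriv_of_leibniz {f x : A} {w : ℝ → A} (hw0 : w 0 = 0)
    (hw : HasDerivAt w x 0)
    (hadd : ∀ u v : ℝ, w (u + v) = w u * NormedSpace.exp ((v : ℂ) • f) +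
      NormedSpace.exp ((u : ℂ) • f) * w v) (v : ℝ) :
    HasDerivAt (fun v : ℝ => NormedSpace.exp (-((v : ℂ) • f)) * w v)
      (NormedSpace.exp (-((v : ℂ) • f)) * x * NormedSpace.exp ((v : ℂ) • f)) v := by
  simpa using hasDerivAt_logDeriv (C := fun _ _ => 0) (c := fun _ => 0) hw0 hw (fun _ => rfl)
    (fun _ => hasDerivAt_const _ _) (by simpa using hadd) v

theorem continuous_exp_conj (f x : A) : Continuous fun v : ℝ =>
    NormedSpace.exp (-((v : ℂ) • f)) * x * NormedSpace.exp ((v : ℂ) • f) := by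
  have hc : Continuous fun v : ℝ => NormedSpace.exp (-((v : ℂ) • f)) := by
    simpa using continuous_exp_ofReal_smul (-f)
  exact (hc.mul continuous_const).mul (continuous_exp_ofReal_smul f)

/-- The derivative of the right-hand side in `v` is `e^{-vf} x e^{vf} = ∑ vⁿ ∇ⁿ x / n!`, which is
integrated term by term. With `w u = δ(e^{uf})` and `v = 1` this is the expansion of `e^{-f}
δ(e^f)`. -/
theorem logDeriv_hasSum {f x : A} {w : ℝ → A} (hw0 : w 0 = 0) (hw : HasDerivAt w x 0)
    (hadd : ∀ u v : ℝ, w (u + v) = w u * NormedSpace.exp ((v : ℂ) • f) +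
      NormedSpace.exp ((u : ℂ) • f) * w v) {v : ℝ} (hv : v ∈ Set.Icc (0 : ℝ) 1) :
    HasSum (fun n : ℕ => (v : ℂ) ^ (n + 1) • (((n + 1)! : ℂ)⁻¹ • (innerDer f ^ n) x))
      (NormedSpace.exp (-((v : ℂ) • f)) * w v) := by
  refine (hasSum_primitive (fun n : ℕ => n) (fun n => (n ! : ℂ)⁻¹ • (innerDer f ^ n) x)
    (summable_norm_pow_div_factorial _ _) (by simp [hw0]) (hasDerivAt_logDeriv_of_leibniz hw0 hw hadd)
    (continuous_exp_conj f x) (fun r _ => exp_conj_hasSum f x r) hv).congr_fun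
    fun n => ?_
  rw [smul_smul, smul_smul, Nat.factorial_succ]
  congr 1
  push_cast
  field_simp

/-- The second-order part of the exponential: if `w`, `w₂` satisfy the first and second order
Leibniz rules along `u ↦ exp (u f)`, then `exp (-f) w₂ 1` is
`∑ ∇ⁿ x₂ / (n + 1)! + 2 ∑ qₘₙ ∇ᵐ x ∇ⁿ x`. -/
theorem logDeriv₂_hasSum {f x x₂ : A} {w w₂ : ℝ → A} (hw0 : w 0 = 0) (hw : HasDerivAt w x 0)
    (hadd : ∀ u v : ℝ, w (u + v) = w u * NormedSpace.exp ((v : ℂ) • f) +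
      NormedSpace.exp ((u : ℂ) • f) * w v)
    (hw0₂ : w₂ 0 = 0) (hw₂ : HasDerivAt w₂ x₂ 0)
    (hadd₂ : ∀ u v : ℝ, w₂ (u + v) = w₂ u * NormedSpace.exp ((v : ℂ) • f) + (2 : ℂ) • (w u * w v) +
      NormedSpace.exp ((u : ℂ) • f) * w₂ v) :
    ∃ S Q : A, HasSum (fun n : ℕ => ((n + 1)! : ℂ)⁻¹ • (innerDer f ^ n) x₂) S ∧
      HasSum (fun p : ℕ × ℕ => qCoeff p • ((innerDer f ^ p.1) x * (innerDer f ^ p.2) x)) Q ∧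
      NormedSpace.exp (-f) * w₂ 1 = S + (2 : ℂ) • Q := by
  have hy := hasDerivAt_logDeriv_of_leibniz hw0 hw hadd
  have hyc : Continuous fun v : ℝ => NormedSpace.exp (-((v : ℂ) • f)) * w v :=
    continuous_iff_continuousAt.2 fun v => (hy v).continuousAt
  have hz : ∀ v : ℝ, HasDerivAt (fun v : ℝ => NormedSpace.exp (-((v : ℂ) • f)) * w₂ v)
      (NormedSpace.exp (-((v : ℂ) • f)) * x₂ * NormedSpace.exp ((v : ℂ) • f) +
        (2 : ℂ) • ((NormedSpace.exp (-((v : ℂ) • f)) * x * NormedSpace.exp ((v : ℂ) • f)) *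
          (NormedSpace.exp (-((v : ℂ) • f)) * w v))) v := by
    intro v
    refine (hasDerivAt_logDeriv hw0₂ hw₂ (C := fun u v => (2 : ℂ) • (w u * w v))
      (c := fun v => (2 : ℂ) • (x * w v)) (fun v => by simp [hw0])
      (fun v => (hw.mul_const _).fun_const_smul (2 : ℂ)) hadd₂ v).congr_deriv ?_
    -- Inserting `e^{vf} e^{-vf} = 1` between `x` and `w v` turns the correction term into a product
    -- of the conjugate of `x` and the first logarithmic derivative.
    have h5 := exp_neg_mul_exp (-((v : ℂ) • f))
    rw [neg_neg] at h5
    rw [mul_smul_comm]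
    simp only [mul_assoc]
    rw [← mul_assoc (NormedSpace.exp ((v : ℂ) • f)), h5, one_mul]
  obtain ⟨S, Q, hS, hQ, h⟩ := hasSum_primitive_mul
    (summable_norm_pow_div_factorial (innerDer f) x)
    (summable_norm_pow_div_factorial_succ (innerDer f) x)
    (summable_norm_pow_div_factorial (innerDer f) x₂)
    (fun r _ => exp_conj_hasSum f x r) (fun r hr => logDeriv_hasSum hw0 hw hadd hr)
    (fun r _ => exp_conj_hasSum f x₂ r) (continuous_exp_conj f x) hyc (continuous_exp_conj f x₂)
    (by simp [hw0₂]) hz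
  refine ⟨S, Q, hS.congr_fun fun n => ?_, hQ.congr_fun fun p => ?_, by simpa using h⟩
  · rw [smul_smul, Nat.factorial_succ, Nat.cast_mul, mul_inv, Nat.cast_succ]
  · simp only [qCoeff, smul_mul_assoc, mul_smul_comm, smul_smul]
    congr 1
    ring

end BanachAlgebra

/-! ### The functions `K` and `H` -/

theorem hasSum_expm1_div {s : ℂ} (hs : s ≠ 0) :
    HasSum (fun n : ℕ => ((n + 1)! : ℂ)⁻¹ * s ^ n) ((Complex.exp s - 1) / s) := by
  have h1 : HasSum (fun n : ℕ => s ^ n / (n ! : ℂ)) (Complex.exp s) := by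
    rw [Complex.exp_eq_exp_ℂ]
    exact NormedSpace.expSeries_div_hasSum_exp s
  have h2 := (hasSum_nat_add_iff' 1).2 h1
  refine ((by simpa using h2 : HasSum (fun n : ℕ => s ^ (n + 1) / ((n + 1)! : ℂ))
    (Complex.exp s - 1)).div_const s).congr_fun fun n => ?_
  rw [pow_succ]
  field_simp

/-- Weierstrass test on closed balls. Continuity of the sum is what identifies the values of `K` and
`H` at their removable singularities. -/
theorem continuous_tsum_powers {c : ℕ × ℕ → ℂ} {B : ℝ}
    (hc : ∀ p, ‖c p‖ ≤ B * ((p.1 ! : ℝ)⁻¹ * (p.2 ! : ℝ)⁻¹)) :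
    (∀ z : ℂ × ℂ, Summable fun p : ℕ × ℕ => c p * (z.1 ^ p.1 * z.2 ^ p.2)) ∧
    Continuous fun z : ℂ × ℂ => ∑' p : ℕ × ℕ, c p * (z.1 ^ p.1 * z.2 ^ p.2) := by
  have hB : ∀ R : ℝ, 0 ≤ R → Summable fun p : ℕ × ℕ => B * (R ^ p.1 / p.1 ! * (R ^ p.2 / p.2 !)) :=
    fun R hR => ((Real.summable_pow_div_factorial R).mul_of_nonneg
      (Real.summable_pow_div_factorial R) (fun _ => by positivity)
      (fun _ => by positivity)).mul_left B
  have hle : ∀ (R : ℝ) (p : ℕ × ℕ) (z : ℂ × ℂ), ‖z‖ ≤ R →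
      ‖c p * (z.1 ^ p.1 * z.2 ^ p.2)‖ ≤ B * (R ^ p.1 / p.1 ! * (R ^ p.2 / p.2 !)) := by
    intro R p z hz
    have hR : 0 ≤ R := (norm_nonneg z).trans hz
    have h1 : ‖z.1‖ ≤ R := (norm_fst_le z).trans hz
    have h2 : ‖z.2‖ ≤ R := (norm_snd_le z).trans hz
    rw [norm_mul, norm_mul, norm_pow, norm_pow]
    calc _ ≤ B * ((p.1 ! : ℝ)⁻¹ * (p.2 ! : ℝ)⁻¹) * (R ^ p.1 * R ^ p.2) := by
          have := (norm_nonneg _).trans (hc p)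
          gcongr
          exact hc p
      _ = _ := by ring
  refine ⟨fun z => Summable.of_norm_bounded (hB ‖z‖ (norm_nonneg z)) fun p => hle _ p z le_rfl,
    continuous_iff_continuousAt.2 fun z => ?_⟩
  have hR : 0 ≤ ‖z‖ + 1 := by positivity
  have h := continuousOn_tsum (s := Metric.closedBall (0 : ℂ × ℂ) (‖z‖ + 1))
    (f := fun (p : ℕ × ℕ) (z : ℂ × ℂ) => c p * (z.1 ^ p.1 * z.2 ^ p.2))
    (fun p => Continuous.continuousOn (by fun_prop)) (hB _ hR)
    (fun p z hz => hle _ p z (by simpa using hz))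
  refine h.continuousAt (Metric.closedBall_mem_nhds_of_mem ?_)
  simp

theorem hasSum_K (s : ℂ) : HasSum (fun n : ℕ => ((n + 1)! : ℂ)⁻¹ * s ^ n) (K s) := by
  -- The one-variable series is the two-variable one restricted to second variable `0`, with
  -- coefficients supported on `p.2 = 0`; there `0 ^ 0 = 1`.
  let c : ℕ × ℕ → ℂ := fun p => if p.2 = 0 then ((p.1 + 1)! : ℂ)⁻¹ else 0
  have hc : ∀ p, ‖c p‖ ≤ 1 * ((p.1 ! : ℝ)⁻¹ * (p.2 ! : ℝ)⁻¹) := by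
    rintro ⟨m, n⟩
    rcases n with _ | n
    · have : (m ! : ℝ) ≤ ((m + 1)! : ℝ) := by exact_mod_cast Nat.factorial_le m.le_succ
      simp only [c, if_true, norm_inv, Complex.norm_natCast, Nat.factorial_zero, Nat.cast_one,
        inv_one, mul_one, one_mul]
      gcongr
    · simp only [c, Nat.succ_ne_zero, if_false, norm_zero]
      positivity
  obtain ⟨hsum, hcont⟩ := continuous_tsum_powers hc
  have hS : ∀ s : ℂ, HasSum (fun n : ℕ => ((n + 1)! : ℂ)⁻¹ * s ^ n)
      (∑' p : ℕ × ℕ, c p * (s ^ p.1 * (0 : ℂ) ^ p.2)) := by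
    intro s
    refine ((hsum (s, 0)).hasSum.prod_fiberwise (g := fun n : ℕ => ((n + 1)! : ℂ)⁻¹ * s ^ n)
      fun m => ?_)
    convert hasSum_ite_eq (0 : ℕ) (((m + 1)! : ℂ)⁻¹ * s ^ m) using 2 with n
    by_cases h : n = 0 <;> simp [c, h]
  have hK : K s = ∑' p : ℕ × ℕ, c p * (s ^ p.1 * (0 : ℂ) ^ p.2) := by
    refine extendFrom_eq ((dense_compl_singleton (0 : ℂ)) s) ?_
    have h1 : Tendsto (fun s : ℂ => ∑' p : ℕ × ℕ, c p * (s ^ p.1 * (0 : ℂ) ^ p.2))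
        (𝓝[{s | s ≠ 0}] s) (𝓝 (∑' p : ℕ × ℕ, c p * (s ^ p.1 * (0 : ℂ) ^ p.2))) :=
      ((hcont.comp (Continuous.prodMk_left (0 : ℂ))).tendsto s).mono_left nhdsWithin_le_nhds
    refine h1.congr' (eventually_nhdsWithin_of_forall fun z hz => ?_)
    exact (hS z).unique (hasSum_expm1_div hz)
  rw [hK]
  exact hS s

/-- The Taylor coefficients of `H`. -/
def hCoeff (p : ℕ × ℕ) : ℂ :=
  (2 : ℂ)⁻¹ * (((p.1 + 1)! : ℂ)⁻¹ * ((p.2 + 1)! : ℂ)⁻¹) - 2 * qCoeff p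

theorem norm_hCoeff_le (p : ℕ × ℕ) : ‖hCoeff p‖ ≤ 3 * ((p.1 ! : ℝ)⁻¹ * (p.2 ! : ℝ)⁻¹) := by
  have h1 : (p.1 ! : ℝ) ≤ ((p.1 + 1)! : ℝ) := by exact_mod_cast Nat.factorial_le p.1.le_succ
  have h2 : (p.2 ! : ℝ) ≤ ((p.2 + 1)! : ℝ) := by exact_mod_cast Nat.factorial_le p.2.le_succ
  have h3 : ‖((p.1 : ℂ) + p.2 + 2)⁻¹‖ ≤ 1 := by
    rw [norm_inv, show (p.1 : ℂ) + p.2 + 2 = ((p.1 + p.2 + 2 : ℕ) : ℂ) by push_cast; ring,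
      Complex.norm_natCast]
    exact inv_le_one_of_one_le₀ (by exact_mod_cast Nat.succ_pos _)
  have h4 : ‖qCoeff p‖ ≤ 1 * ((p.1 ! : ℝ)⁻¹ * (p.2 ! : ℝ)⁻¹) := by
    simp only [qCoeff, norm_mul, norm_inv _, Complex.norm_natCast] at h3 ⊢
    gcongr
  have h5 : ‖(((p.1 + 1)! : ℂ)⁻¹ * ((p.2 + 1)! : ℂ)⁻¹)‖ ≤ (p.1 ! : ℝ)⁻¹ * (p.2 ! : ℝ)⁻¹ := by
    simp only [norm_mul, norm_inv, Complex.norm_natCast]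
    gcongr
  have h6 := norm_sub_le ((2 : ℂ)⁻¹ * (((p.1 + 1)! : ℂ)⁻¹ * ((p.2 + 1)! : ℂ)⁻¹)) (2 * qCoeff p)
  rw [norm_mul (2 : ℂ)⁻¹, norm_mul 2, norm_inv (2 : ℂ), Complex.norm_ofNat] at h6
  have h7 : (0 : ℝ) ≤ (p.1 ! : ℝ)⁻¹ * (p.2 ! : ℝ)⁻¹ := by positivity
  -- The two parts contribute at most `1/2` and `2` times the common bound.
  unfold hCoeff
  linarith

/-- The sum is `∫₀¹ e^{vs} (e^{vt} - 1)/t dv`. It is expanded by `hasSum_primitive_mul`, the lemma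
already used in the Banach algebra, so the same coefficients appear in both places. The factor 2 in
`F` matches the one in that lemma. -/
theorem hasSum_qCoeff {s t : ℂ} (hs : s ≠ 0) (ht : t ≠ 0) (hst : s + t ≠ 0) :
    HasSum (fun p : ℕ × ℕ => qCoeff p * (s ^ p.1 * t ^ p.2))
      (((Complex.exp (s + t) - 1) / (s + t) - (Complex.exp s - 1) / s) / t) := by
  have hexp : ∀ z : ℂ, HasSum (fun n : ℕ => (n ! : ℂ)⁻¹ * z ^ n) (Complex.exp z) := by
    intro z
    rw [Complex.exp_eq_exp_ℂ]
    simpa using NormedSpace.exp_series_hasSum_exp' (𝕂 := ℂ) z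
  have hd : ∀ (z : ℂ) (v : ℝ), HasDerivAt (fun v : ℝ => Complex.exp (v * z))
      (Complex.exp (v * z) * z) v := by
    intro z v
    have := (((hasDerivAt_id v).ofReal_comp).mul_const z).cexp
    simpa using this
  have hc : ∀ z : ℂ, Continuous fun v : ℝ => Complex.exp (v * z) := fun z => by fun_prop
  have ha : Summable fun n : ℕ => ‖(n ! : ℂ)⁻¹ * s ^ n‖ := by
    simpa [div_eq_inv_mul] using Real.summable_pow_div_factorial ‖s‖
  have hb : Summable fun n : ℕ => ‖((n + 1)! : ℂ)⁻¹ * t ^ n‖ := by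
    refine Summable.of_nonneg_of_le (fun _ => norm_nonneg _) (fun n => ?_)
      (Real.summable_pow_div_factorial ‖t‖)
    have : (n ! : ℝ) ≤ ((n + 1)! : ℝ) := by exact_mod_cast Nat.factorial_le n.le_succ
    rw [norm_mul, norm_inv, Complex.norm_natCast, norm_pow, div_eq_inv_mul]
    gcongr
  obtain ⟨S, Q, hS, hQ, h⟩ := hasSum_primitive_mul (A := ℂ) (d := fun _ => 0)
    (a := fun n : ℕ => (n ! : ℂ)⁻¹ * s ^ n) (b := fun n : ℕ => ((n + 1)! : ℂ)⁻¹ * t ^ n)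
    (F := fun v => 2 * (((Complex.exp (v * (s + t)) - 1) / (s + t) -
      (Complex.exp (v * s) - 1) / s) / t))
    (α := fun v => Complex.exp (v * s)) (β := fun v => (Complex.exp (v * t) - 1) / t)
    (γ := fun _ => 0) ha hb (by simp)
    (fun r _ => (hexp (r * s)).congr_fun fun n => by rw [mul_pow, smul_eq_mul]; ring)
    (fun r _ => by
      by_cases hr : (r : ℂ) = 0
      · simp [hr, hasSum_zero]
      · have h := (hasSum_expm1_div (mul_ne_zero hr ht)).mul_left (r : ℂ)
        rw [show (r : ℂ) * ((Complex.exp (r * t) - 1) / (r * t)) = (Complex.exp (r * t) - 1) / t by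
          field_simp] at h
        refine h.congr_fun fun n => ?_
        rw [mul_pow, smul_eq_mul]
        ring)
    (fun r _ => by simp [hasSum_zero]) (hc s) (((hc t).sub continuous_const).div_const t)
    continuous_const (by simp)
    (fun v => by
      refine ((((((hd (s + t) v).sub_const 1).div_const (s + t)).fun_sub
        (((hd s v).sub_const 1).div_const s)).div_const t).const_mul 2).congr_deriv ?_
      rw [mul_add (v : ℂ), Complex.exp_add, smul_eq_mul]
      field_simp
      ring)
  have hS0 : S = 0 := hS.unique (by simp [hasSum_zero])
  have hQe : Q = ((Complex.exp (s + t) - 1) / (s + t) - (Complex.exp s - 1) / s) / t := by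
    simpa [hS0] using h.symm
  rw [← hQe]
  refine hQ.congr_fun fun p => ?_
  simp only [qCoeff, smul_eq_mul]
  ring

/-- The closed form equals `½ K(s) K(t) - 2 q(s, t)`, with `q` the sum in `hasSum_qCoeff`. -/
theorem hasSum_hCoeff {s t : ℂ} (hs : s ≠ 0) (ht : t ≠ 0) (hst : s + t ≠ 0) :
    HasSum (fun p : ℕ × ℕ => hCoeff p * (s ^ p.1 * t ^ p.2))
      ((s * (Complex.exp t - 1) * (-3 * Complex.exp s - 1) +
        t * (Complex.exp s - 1) * (Complex.exp t + 3)) / (2 * s * t * (s + t))) := by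
  have hsum : ∀ z : ℂ, Summable fun n : ℕ => ‖((n + 1)! : ℂ)⁻¹ * z ^ n‖ := by
    intro z
    refine Summable.of_nonneg_of_le (fun _ => norm_nonneg _) (fun n => ?_)
      (Real.summable_pow_div_factorial ‖z‖)
    have : (n ! : ℝ) ≤ ((n + 1)! : ℝ) := by exact_mod_cast Nat.factorial_le n.le_succ
    rw [norm_mul, norm_inv, Complex.norm_natCast, norm_pow, div_eq_inv_mul]
    gcongr
  have h1 := (hasSum_prod_mul (hsum s) (hsum t) (hasSum_expm1_div hs)
    (hasSum_expm1_div ht)).mul_left (2 : ℂ)⁻¹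
  have h2 := (hasSum_qCoeff hs ht hst).mul_left 2
  have h3 := h1.sub h2
  rw [Complex.exp_add] at h3
  have h4 : (s * (Complex.exp t - 1) * (-3 * Complex.exp s - 1) +
      t * (Complex.exp s - 1) * (Complex.exp t + 3)) / (2 * s * t * (s + t)) =
      2⁻¹ * ((Complex.exp s - 1) / s * ((Complex.exp t - 1) / t)) -
        2 * (((Complex.exp s * Complex.exp t - 1) / (s + t) - (Complex.exp s - 1) / s) / t) := by
    field_simp
    ring
  rw [h4]
  refine h3.congr_fun fun p => ?_
  simp only [hCoeff]
  ring

theorem hasSum_H (z : ℂ × ℂ) :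
    HasSum (fun p : ℕ × ℕ => hCoeff p * (z.1 ^ p.1 * z.2 ^ p.2)) (H z) := by
  obtain ⟨hsum, hcont⟩ := continuous_tsum_powers norm_hCoeff_le
  have hcl : z ∈ closure {p : ℂ × ℂ | p.1 * p.2 * (p.1 + p.2) ≠ 0} := by
    -- A diagonal shift by `ε` meets the singular set for only three values of `ε`, so regular
    -- points accumulate at `z`.
    have hlim : Tendsto (fun ε : ℂ => (z.1 + ε, z.2 + ε)) (𝓝[≠] 0) (𝓝 z) := by
      have : Continuous fun ε : ℂ => (z.1 + ε, z.2 + ε) := by fun_prop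
      simpa using (this.tendsto 0).mono_left nhdsWithin_le_nhds
    refine mem_closure_of_tendsto hlim ?_
    have hne : ∀ w : ℂ, ∀ᶠ ε in 𝓝[≠] (0 : ℂ), ε ≠ w := by
      intro w
      by_cases hw : w = 0
      · rw [hw]
        exact eventually_mem_nhdsWithin
      · exact (eventually_ne_nhds (Ne.symm hw)).filter_mono nhdsWithin_le_nhds
    filter_upwards [hne (-z.1), hne (-z.2), hne (-(z.1 + z.2) / 2)] with ε h1 h2 h3
    refine mul_ne_zero (mul_ne_zero ?_ ?_) ?_
    · exact fun h => h1 (by linear_combination h)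
    · exact fun h => h2 (by linear_combination h)
    · exact fun h => h3 (by linear_combination h / 2)
  have hH : H z = ∑' p : ℕ × ℕ, hCoeff p * (z.1 ^ p.1 * z.2 ^ p.2) := by
    refine extendFrom_eq hcl (((hcont.tendsto z).mono_left nhdsWithin_le_nhds).congr'
      (eventually_nhdsWithin_of_forall fun w hw => ?_))
    have h := mul_ne_zero_iff.1 hw
    have h' := mul_ne_zero_iff.1 h.1
    exact (hasSum_hCoeff h'.1 h'.2 h.2).tsum_eq
  rw [hH]
  exact (hsum z).hasSum

/-! ### Taylor coefficients of `K` and `H` at the origin. -/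

theorem K_taylor (n : ℕ) : iteratedDeriv n K 0 / (n ! : ℂ) = ((n + 1)! : ℂ)⁻¹ := by
  have : (n ! : ℂ) ≠ 0 := by exact_mod_cast n.factorial_ne_zero
  rw [iteratedDeriv_zero_of_hasSum hasSum_K n]
  field_simp

theorem H_taylor (p : ℕ × ℕ) :
    iteratedDeriv p.1 (fun s => iteratedDeriv p.2 (fun t => H (s, t)) 0) 0 /
      ((p.1 ! : ℂ) * (p.2 ! : ℂ)) = hCoeff p := by
  have h1 : (p.1 ! : ℂ) ≠ 0 := by exact_mod_cast p.1.factorial_ne_zero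
  have h2 : (p.2 ! : ℂ) ≠ 0 := by exact_mod_cast p.2.factorial_ne_zero
  have hsum := (continuous_tsum_powers norm_hCoeff_le).1
  have hin : ∀ (s : ℂ) (n : ℕ), Summable fun m : ℕ => hCoeff (m, n) * s ^ m := by
    intro s n
    -- Setting the second variable to `1` makes a column of the double series free of powers of `t`.
    have := (hsum (s, 1)).comp_injective (i := fun m : ℕ => (m, n))
      fun a b h => (Prod.ext_iff.1 h).1
    simpa [Function.comp_def] using this
  have hs : ∀ s : ℂ, iteratedDeriv p.2 (fun t => H (s, t)) 0 =
      (p.2 ! : ℂ) * ∑' m : ℕ, hCoeff (m, p.2) * s ^ m := by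
    intro s
    refine iteratedDeriv_zero_of_hasSum (a := fun n => ∑' m : ℕ, hCoeff (m, n) * s ^ m)
      (fun t => ?_) p.2
    have h := (Equiv.prodComm ℕ ℕ).hasSum_iff.2 (hasSum_H (s, t))
    refine h.prod_fiberwise fun n => ?_
    refine ((hin s n).hasSum.mul_right (t ^ n)).congr_fun fun m => ?_
    simp [mul_assoc]
  rw [funext hs, iteratedDeriv_zero_of_hasSum (a := fun m => (p.2 ! : ℂ) * hCoeff (m, p.2))
    (fun s => ?_) p.1]
  · field_simp
  · refine ((hin s p.2).hasSum.mul_left (p.2 ! : ℂ)).congr_fun fun m => ?_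
    ring

/-! ### Derivatives of exponentials in the smooth torus -/

theorem action_zero {n : ℕ} (Θ : Matrix (Fin n) (Fin n) ℝ) (x : Torus Θ) : action Θ 0 x = x := by
  have h1 : (diagW (0 : Fin n → ℝ)) = 1 := by
    have := diagW_add (0 : Fin n → ℝ) 0
    rw [add_zero] at this
    exact mul_eq_left.1 this.symm
  apply toOp_injective
  rw [toOp_action, h1]
  simp

theorem action_delta {n : ℕ} {Θ : Matrix (Fin n) (Fin n) ℝ} (j : Fin n) (a : Smooth Θ)
    (s : Fin n → ℝ) : action Θ s (delta Θ j a : Torus Θ) =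
      (2 * Real.pi : ℝ) • fderiv ℝ (fun t => action Θ t (a : Torus Θ)) s (Pi.single j 1) := by
  rw [coe_delta, map_smul, action_fderiv, Complex.coe_smul]

/-- Both sides are `(2π)²` times a second derivative at `0` of the orbit map, which is symmetric. -/
theorem delta_comm {n : ℕ} {Θ : Matrix (Fin n) (Fin n) ℝ} (i j : Fin n) (a : Smooth Θ) :
    delta Θ i (delta Θ j a) = delta Θ j (delta Θ i a) := by
  have key : ∀ i j, (delta Θ i (delta Θ j a) : Torus Θ) = (2 * Real.pi : ℝ) • (2 * Real.pi : ℝ) •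
      fderiv ℝ (fderiv ℝ fun t => action Θ t (a : Torus Θ)) 0 (Pi.single i 1) (Pi.single j 1) := by
    intro i j
    have hd : DifferentiableAt ℝ (fderiv ℝ fun t => action Θ t (a : Torus Θ)) 0 :=
      ((contDiff_action a).fderiv_right (m := ∞) (by simp)).differentiable (by simp) 0
    rw [coe_delta, Complex.coe_smul]
    congr 1
    simp only [action_delta]
    rw [fderiv_fun_const_smul (hd.clm_apply (differentiableAt_const _)), smul_apply,
      fderiv_clm_apply hd (differentiableAt_const _)]
    simp
  apply Subtype.ext
  rw [key, key]
  congr 2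
  have hs : IsSymmSndFDerivAt ℝ (fun t => action Θ t (a : Torus Θ)) 0 :=
    (contDiff_infty.1 (contDiff_action a) 2).contDiffAt.isSymmSndFDerivAt (by simp)
  exact hs _ _

/-! ### Chain rule for the exponential along orbits of the action. -/

theorem contDiff_exp (A : Type*) [NormedRing A] [NormedAlgebra ℂ A] [CompleteSpace A] :
    ContDiff ℝ ∞ (NormedSpace.exp : A → A) :=
  contDiff_iff_contDiffAt.2 fun x => (NormedSpace.exp_analytic (𝕂 := ℝ) x).contDiffAt

theorem action_exp {n : ℕ} {Θ : Matrix (Fin n) (Fin n) ℝ} (s : Fin n → ℝ) (a : Torus Θ) :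
    action Θ s (NormedSpace.exp a) = NormedSpace.exp (action Θ s a) := by
  let _ : NormedAlgebra ℚ (Torus Θ) := NormedAlgebra.restrictScalars ℚ ℂ (Torus Θ)
  exact NormedSpace.map_exp (action Θ s) (continuous_action Θ s) a

/-- The action commutes with `exp`, so the orbit of `e^a` is `exp` composed with the orbit of `a`.
The formula holds at every `s`, so that it can be differentiated once more in `delta_delta_expS`. -/
theorem action_delta_expS {n : ℕ} {Θ : Matrix (Fin n) (Fin n) ℝ} (j : Fin n) (a : Smooth Θ)
    (s : Fin n → ℝ) : action Θ s (delta Θ j (expS a) : Torus Θ) =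
      fderiv ℝ (NormedSpace.exp : Torus Θ → Torus Θ) (action Θ s (a : Torus Θ))
        (action Θ s (delta Θ j a : Torus Θ)) := by
  rw [action_delta, action_delta, map_smul]
  congr 1
  have h : (fun t => action Θ t (expS a : Torus Θ)) =
      NormedSpace.exp ∘ fun t => action Θ t (a : Torus Θ) := by
    ext1 t
    exact action_exp t _
  rw [h, fderiv_comp s ((contDiff_exp (Torus Θ)).differentiable (by simp) _)
    (differentiable_action a s)]
  rfl

theorem delta_delta_expS {n : ℕ} {Θ : Matrix (Fin n) (Fin n) ℝ} (j : Fin n) (a : Smooth Θ) :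
    (delta Θ j (delta Θ j (expS a)) : Torus Θ) =
      fderiv ℝ (fderiv ℝ (NormedSpace.exp : Torus Θ → Torus Θ)) a (delta Θ j a : Torus Θ)
        (delta Θ j a : Torus Θ) +
      fderiv ℝ (NormedSpace.exp : Torus Θ → Torus Θ) a (delta Θ j (delta Θ j a) : Torus Θ) := by
  have hE : Differentiable ℝ (fderiv ℝ (NormedSpace.exp : Torus Θ → Torus Θ)) :=
    ((contDiff_exp (Torus Θ)).fderiv_right (m := ∞) (by simp)).differentiable (by simp)
  have hc := (hE (action Θ 0 (a : Torus Θ))).hasFDerivAt.comp (0 : Fin n → ℝ)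
    (differentiable_action a 0).hasFDerivAt
  have h := hc.clm_apply (differentiable_action (delta Θ j a) 0).hasFDerivAt
  have h' : HasFDerivAt (fun s => action Θ s (delta Θ j (expS a) : Torus Θ)) _ 0 :=
    h.congr_of_eventuallyEq (Eventually.of_forall fun s => action_delta_expS j a s)
  have hz : ∀ b : Smooth Θ, fderiv ℝ (fun t => action Θ t (b : Torus Θ)) 0 (Pi.single j 1) =
      (2 * Real.pi : ℝ)⁻¹ • (delta Θ j b : Torus Θ) := by
    intro b
    rw [coe_delta, Complex.coe_smul, inv_smul_smul₀ (by positivity)]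
  rw [coe_delta, Complex.coe_smul, h'.fderiv]
  simp only [add_apply, ContinuousLinearMap.coe_comp, Function.comp_apply,
    ContinuousLinearMap.flip_apply, hz, action_zero, map_smul, smul_apply, smul_add]
  rw [smul_inv_smul₀ (by positivity), smul_inv_smul₀ (by positivity), add_comm]

theorem expS_add_smul {n : ℕ} {Θ : Matrix (Fin n) (Fin n) ℝ} (f : Smooth Θ) (u v : ℝ) :
    expS (((u + v : ℝ) : ℂ) • f) = expS ((u : ℂ) • f) * expS ((v : ℂ) • f) :=
  Subtype.ext (exp_ofReal_smul_add (f : Torus Θ) u v)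

theorem expS_neg_mul {n : ℕ} {Θ : Matrix (Fin n) (Fin n) ℝ} (f : Smooth Θ) :
    expS (-f) * expS f = 1 :=
  Subtype.ext (exp_neg_mul_exp (f : Torus Θ))

theorem expS_mul_neg {n : ℕ} {Θ : Matrix (Fin n) (Fin n) ℝ} (f : Smooth Θ) :
    expS f * expS (-f) = 1 := by
  simpa using expS_neg_mul (-f)

/-- The first and second derivatives of `e^f` as series in the modular derivation. -/
theorem delta_expS_hasSum {n : ℕ} {Θ : Matrix (Fin n) (Fin n) ℝ} (j : Fin n) (f : Smooth Θ) :
    HasSum (fun n : ℕ => ((n + 1)! : ℂ)⁻¹ • (innerDer (f : Torus Θ) ^ n) (delta Θ j f : Torus Θ))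
      (NormedSpace.exp (-(f : Torus Θ)) * (delta Θ j (expS f) : Torus Θ)) ∧
    ∃ S Q : Torus Θ,
      HasSum (fun n : ℕ => ((n + 1)! : ℂ)⁻¹ •
        (innerDer (f : Torus Θ) ^ n) (delta Θ j (delta Θ j f) : Torus Θ)) S ∧
      HasSum (fun p : ℕ × ℕ => qCoeff p • ((innerDer (f : Torus Θ) ^ p.1) (delta Θ j f : Torus Θ) *
        (innerDer (f : Torus Θ) ^ p.2) (delta Θ j f : Torus Θ))) Q ∧
      NormedSpace.exp (-(f : Torus Θ)) * (delta Θ j (delta Θ j (expS f)) : Torus Θ) =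
        S + (2 : ℂ) • Q := by
  let E : Torus Θ → Torus Θ := NormedSpace.exp
  have hE : ContDiff ℝ ∞ E := contDiff_exp (Torus Θ)
  have hE1 : ContDiff ℝ ∞ (fderiv ℝ E) := hE.fderiv_right (by simp)
  have hE2 : ContDiff ℝ ∞ (fderiv ℝ (fderiv ℝ E)) := hE1.fderiv_right (by simp)
  have hE0 : fderiv ℝ E 0 = ContinuousLinearMap.id ℝ (Torus Θ) :=
    (hasFDerivAt_exp_zero (𝕂 := ℝ) (𝔸 := Torus Θ)).fderiv
  have hsm : ContDiff ℝ ∞ fun u : ℝ => u • (f : Torus Θ) := contDiff_id.smul contDiff_const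
  -- The logarithmic derivative lemmas only need the values and derivatives of `w`, `w₂` at `0`,
  -- besides the Leibniz rules. The chain rule exhibits both functions as `u • g u` with `g` smooth,
  -- so the value at `0` is `0` and the derivative there is `g 0`; as the derivative of `exp` at `0`
  -- is the identity, `g 0` is `δ_j f` and `δ_j² f` respectively.
  let w : ℝ → Torus Θ := fun u => (delta Θ j (expS ((u : ℂ) • f)) : Torus Θ)
  let w₂ : ℝ → Torus Θ := fun u => (delta Θ j (delta Θ j (expS ((u : ℂ) • f))) : Torus Θ)
  have hcoe : ∀ (u : ℝ) (a : Smooth Θ), (((u : ℂ) • a : Smooth Θ) : Torus Θ) = u • (a : Torus Θ) :=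
    fun u a => Complex.coe_smul u (a : Torus Θ)
  have hw : ∀ u, w u = u • fderiv ℝ E (u • (f : Torus Θ)) (delta Θ j f : Torus Θ) := by
    intro u
    have h := action_delta_expS j ((u : ℂ) • f) 0
    rw [action_zero, action_zero, action_zero, map_smul, hcoe, hcoe, map_smul] at h
    exact h
  have hw₂ : ∀ u, w₂ u = u • (u • fderiv ℝ (fderiv ℝ E) (u • (f : Torus Θ))
      (delta Θ j f : Torus Θ) (delta Θ j f : Torus Θ) +
      fderiv ℝ E (u • (f : Torus Θ)) (delta Θ j (delta Θ j f) : Torus Θ)) := by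
    intro u
    have h := delta_delta_expS j ((u : ℂ) • f)
    rw [map_smul (delta Θ j), map_smul (delta Θ j), hcoe, hcoe, hcoe, map_smul, map_smul, map_smul,
      smul_apply] at h
    rw [smul_add]
    exact h
  have hd : ∀ g : ℝ → Torus Θ, ContDiff ℝ ∞ g → HasDerivAt (fun u : ℝ => u • g u) (g 0) 0 := by
    intro g hg
    simpa using (hasDerivAt_id (0 : ℝ)).fun_smul (hg.differentiable (by simp) 0).hasDerivAt
  have hc1 : ∀ y : Torus Θ, ContDiff ℝ ∞ fun u : ℝ => fderiv ℝ E (u • (f : Torus Θ)) y :=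
    fun y => (hE1.comp hsm).clm_apply contDiff_const
  have hc2 : ∀ y z : Torus Θ,
      ContDiff ℝ ∞ fun u : ℝ => fderiv ℝ (fderiv ℝ E) (u • (f : Torus Θ)) y z :=
    fun y z => ((hE2.comp hsm).clm_apply contDiff_const).clm_apply contDiff_const
  have h0 : w 0 = 0 := by simp [hw]
  have h0₂ : w₂ 0 = 0 := by simp [hw₂]
  have h1 : HasDerivAt w (delta Θ j f : Torus Θ) 0 := by
    rw [funext hw]
    simpa [hE0] using hd _ (hc1 (delta Θ j f : Torus Θ))
  have h1₂ : HasDerivAt w₂ (delta Θ j (delta Θ j f) : Torus Θ) 0 := by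
    rw [funext hw₂]
    simpa [hE0] using hd _ ((contDiff_id.smul (hc2 (delta Θ j f : Torus Θ) (delta Θ j f))).add
      (hc1 (delta Θ j (delta Θ j f) : Torus Θ)))
  -- The Leibniz rules are `δ_j` and `δ_j²` applied to `e^{(u+v)f} = e^{uf} e^{vf}`.
  have hadd : ∀ u v : ℝ, w (u + v) = w u * NormedSpace.exp ((v : ℂ) • (f : Torus Θ)) +
      NormedSpace.exp ((u : ℂ) • (f : Torus Θ)) * w v := by
    intro u v
    have h := congrArg (fun a => (delta Θ j a : Torus Θ)) (expS_add_smul f u v)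
    simp only [delta_mul] at h
    exact h
  have hadd₂ : ∀ u v : ℝ, w₂ (u + v) = w₂ u * NormedSpace.exp ((v : ℂ) • (f : Torus Θ)) +
      (2 : ℂ) • (w u * w v) + NormedSpace.exp ((u : ℂ) • (f : Torus Θ)) * w₂ v := by
    intro u v
    have h := congrArg (fun a => (delta Θ j (delta Θ j a) : Torus Θ)) (expS_add_smul f u v)
    simp only [delta_mul, map_add] at h
    refine h.trans ?_
    simp only [AddMemClass.coe_add, MulMemClass.coe_mul, two_smul]
    rw [add_assoc, add_assoc, add_assoc]
    rfl
  have hw1 : w 1 = (delta Θ j (expS f) : Torus Θ) := by simp [w]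
  have hw1₂ : w₂ 1 = (delta Θ j (delta Θ j (expS f)) : Torus Θ) := by simp [w₂]
  constructor
  · have h := logDeriv_hasSum h0 h1 hadd (v := 1) ⟨zero_le_one, le_rfl⟩
    simpa [hw1] using h
  · rw [← hw1₂]
    exact logDeriv₂_hasSum h0 h1 hadd h0₂ h1₂ hadd₂

/-! ### Series in the modular derivation -/

theorem modularDerivation_pow_apply {n : ℕ} {Θ : Matrix (Fin n) (Fin n) ℝ} (f x : Torus Θ)
    (m : ℕ) : (modularDerivation f ^ m) x = (innerDer f ^ m) x := by
  induction m with
  | zero => rfl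
  | succ m ih =>
    rw [pow_succ', pow_succ', Module.End.mul_apply, ih,
      show (innerDer f * innerDer f ^ m) x = innerDer f ((innerDer f ^ m) x) from rfl]
    simp [modularDerivation]

theorem calcTerm_K {n : ℕ} {Θ : Matrix (Fin n) (Fin n) ℝ} (f x : Torus Θ) :
    calcTerm K (modularDerivation f) x = fun m => ((m + 1)! : ℂ)⁻¹ • (innerDer f ^ m) x := by
  ext1 m
  rw [calcTerm, K_taylor, modularDerivation_pow_apply]

theorem calcTerm₂_H {n : ℕ} {Θ : Matrix (Fin n) (Fin n) ℝ} (f x y : Torus Θ) :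
    calcTerm₂ H (modularDerivation f) x y =
      fun p => hCoeff p • ((innerDer f ^ p.1) x * (innerDer f ^ p.2) y) := by
  ext1 p
  rw [calcTerm₂, H_taylor, modularDerivation_pow_apply, modularDerivation_pow_apply]

theorem summable_calcTerm_K {n : ℕ} {Θ : Matrix (Fin n) (Fin n) ℝ} (f x : Torus Θ) :
    Summable (calcTerm K (modularDerivation f) x) := by
  rw [calcTerm_K]
  exact (summable_norm_pow_div_factorial_succ (innerDer f) x).of_norm

theorem summable_calcTerm₂_H {n : ℕ} {Θ : Matrix (Fin n) (Fin n) ℝ} (f x y : Torus Θ) :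
    Summable (calcTerm₂ H (modularDerivation f) x y) := by
  rw [calcTerm₂_H]
  refine Summable.of_norm_bounded (((summable_norm_pow_div_factorial (innerDer f) x).mul_norm
    (summable_norm_pow_div_factorial (innerDer f) y)).mul_left 3) fun p => ?_
  rw [norm_smul, smul_mul_smul_comm, norm_smul, norm_mul (_ : ℂ), norm_inv, norm_inv,
    Complex.norm_natCast, Complex.norm_natCast, ← mul_assoc]
  exact mul_le_mul_of_nonneg_right (norm_hCoeff_le p) (norm_nonneg _)

theorem calc₁_K_eq {n : ℕ} {Θ : Matrix (Fin n) (Fin n) ℝ} {f x S : Torus Θ}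
    (h : HasSum (fun m : ℕ => ((m + 1)! : ℂ)⁻¹ • (innerDer f ^ m) x) S) :
    calc₁ K (modularDerivation f) x = S := by
  rw [calc₁, calcTerm_K]
  exact h.tsum_eq

theorem calc₁_K_sum {n : ℕ} {Θ : Matrix (Fin n) (Fin n) ℝ} {ι : Type*} (f : Torus Θ) (s : Finset ι)
    (x : ι → Torus Θ) : calc₁ K (modularDerivation f) (∑ i ∈ s, x i) =
      ∑ i ∈ s, calc₁ K (modularDerivation f) (x i) := by
  refine calc₁_K_eq ((hasSum_sum fun i _ => (summable_calcTerm_K f (x i)).hasSum).congr_fun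
    fun m => ?_)
  simp only [calcTerm_K, map_sum, Finset.smul_sum]

/-- The product of the series of `Y` with itself has the coefficients of `K(s) K(t)`, and `hCoeff`
is half of these minus `2 * qCoeff`. -/
theorem calc₂_H_eq {n : ℕ} {Θ : Matrix (Fin n) (Fin n) ℝ} {f x Y Q : Torus Θ}
    (hY : HasSum (fun m : ℕ => ((m + 1)! : ℂ)⁻¹ • (innerDer f ^ m) x) Y)
    (hQ : HasSum (fun p : ℕ × ℕ => qCoeff p • ((innerDer f ^ p.1) x * (innerDer f ^ p.2) x)) Q) :
    calc₂ H (modularDerivation f) x x = (2 : ℂ)⁻¹ • (Y * Y) - (2 : ℂ) • Q := by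
  rw [calc₂, calcTerm₂_H]
  have hs := summable_norm_pow_div_factorial_succ (innerDer f) x
  have hm := HasSum.mul (f := fun m : ℕ => ((m + 1)! : ℂ)⁻¹ • (innerDer f ^ m) x)
    (g := fun m : ℕ => ((m + 1)! : ℂ)⁻¹ • (innerDer f ^ m) x) hY hY
    (summable_mul_of_summable_norm (f := fun m : ℕ => ((m + 1)! : ℂ)⁻¹ • (innerDer f ^ m) x)
      (g := fun m : ℕ => ((m + 1)! : ℂ)⁻¹ • (innerDer f ^ m) x) hs hs)
  refine (((hm.const_smul (2 : ℂ)⁻¹).sub (hQ.const_smul (2 : ℂ))).congr_fun fun p => ?_).tsum_eq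
  simp only [hCoeff, smul_mul_assoc, mul_smul_comm, smul_smul, sub_smul]
  congr 2
  ring

/-! ### Existence of Levi-Civita connections -/

theorem conformalMetric_pairing {n : ℕ} {Θ : Matrix (Fin n) (Fin n) ℝ} (f : Smooth Θ)
    (hf : IsSelfAdjoint f) (X Y : VectorFields Θ) :
    (conformalMetric f hf).pairing X Y = ∑ i, X i * expS f * star (Y i) := rfl

theorem pairing_partialVec {n : ℕ} {Θ : Matrix (Fin n) (Fin n) ℝ} (f : Smooth Θ)
    (hf : IsSelfAdjoint f) (X : VectorFields Θ) (k : Fin n) :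
    (conformalMetric f hf).pairing X (partialVec Θ k) = X k * expS f := by
  rw [conformalMetric_pairing, Finset.sum_eq_single k]
  · simp [partialVec]
  · intro i _ hi
    simp [partialVec, hi]
  · simp

theorem U_ne_zero {n : ℕ} (Θ : Matrix (Fin n) (Fin n) ℝ) (j : Fin n) : U Θ j ≠ 0 := by
  intro h
  have h1 : (genU Θ j : Op n) = 0 := congrArg (toOp Θ) h
  have h2 : (1 : Op n) = 0 := by
    rw [← Unitary.coe_star_mul_self (genU Θ j), h1, mul_zero]
  have h3 := congrArg (fun T : Op n => T (lp.single 2 (0 : Fin n → ℤ) (1 : ℂ)) 0) h2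
  simp at h3

/-! ### Linear independence of the `∂_j` and construction of connections. -/

theorem partialDer_linearIndependent {n : ℕ} (Θ : Matrix (Fin n) (Fin n) ℝ) :
    LinearIndependent ℝ (partialDer Θ) := by
  rw [Fintype.linearIndependent_iff]
  intro c hc k
  have h := congrArg (fun Z : starDerivations Θ =>
    (Z : Module.End ℂ (Smooth Θ)) ⟨U Θ k, U_mem_smooth Θ k⟩) hc
  have h1 : ∑ j, c j • delta Θ j ⟨U Θ k, U_mem_smooth Θ k⟩ = 0 := by
    simpa [partialDer, LinearMap.sum_apply] using h
  simp only [delta_U] at h1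
  rw [Finset.sum_eq_single k (fun j _ hj => by simp [hj]) (by simp)] at h1
  have h2 : c k • (2 * Real.pi * Complex.I : ℂ) • U Θ k = 0 := by
    simpa using congrArg Subtype.val h1
  simpa [U_ne_zero, Real.pi_ne_zero] using h2

/-- A connection must be defined on all of `𝒟_Θ`, which is not assumed to be spanned by the `∂_j`.
The functionals `l i` are components of a linear left inverse of `ℝⁿ → 𝒟_Θ`; they extend the
coordinates on the span. -/
theorem exists_dual_partialDer {n : ℕ} (Θ : Matrix (Fin n) (Fin n) ℝ) :
    ∃ l : Fin n → starDerivations Θ →ₗ[ℝ] ℝ,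
      ∀ i j, l i (partialDer Θ j) = if i = j then 1 else 0 := by
  have hli := partialDer_linearIndependent Θ
  obtain ⟨g, hg⟩ := LinearMap.exists_leftInverse_of_injective
    (Fintype.linearCombination ℝ (partialDer Θ)) (by
      rw [LinearMap.ker_eq_bot]
      exact linearIndependent_iff_injective_fintypeLinearCombination.1 hli)
  refine ⟨fun i => (LinearMap.proj i).comp g, fun i j => ?_⟩
  have h := congrArg (fun T : (Fin n → ℝ) →ₗ[ℝ] (Fin n → ℝ) => T (Pi.single j 1) i) hg
  simpa [Fintype.linearCombination_apply_single, Pi.single_apply] using h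

/-- The connection with Christoffel symbols `⟨∇_Z ∂_j, ∂_k⟩ = B Z j k`. -/
def christoffelConnection {n : ℕ} {Θ : Matrix (Fin n) (Fin n) ℝ} (f : Smooth Θ)
    (B : Fin n → Fin n → starDerivations Θ →ₗ[ℝ] Smooth Θ) : Connection Θ where
  cov :=
    { toFun := fun Z =>
        { toFun := fun X k => (Z : Module.End ℂ (Smooth Θ)) (X k) +
            ∑ j, X j * B j k Z * expS (-f)
          map_add' := fun X Y => by
            ext1 k
            simp only [Pi.add_apply, map_add, add_mul, Finset.sum_add_distrib]
            abel
          map_smul' := fun c X => by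
            ext1 k
            simp [Finset.smul_sum] }
      map_add' := fun Z W => by
        refine LinearMap.ext fun X => funext fun k => ?_
        simp only [LinearMap.coe_mk, AddHom.coe_mk, LinearMap.add_apply, Pi.add_apply, map_add,
          mul_add, add_mul, Finset.sum_add_distrib, AddMemClass.coe_add]
        abel
      map_smul' := fun c Z => by
        refine LinearMap.ext fun X => funext fun k => ?_
        simp [Finset.smul_sum] }
  leibniz Z a X := by
    ext1 k
    simp only [LinearMap.coe_mk, AddHom.coe_mk, Pi.smul_apply, Pi.add_apply, smul_eq_mul, Z.2.1,
      mul_add, Finset.mul_sum, mul_assoc]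
    abel

theorem christoffelConnection_cov {n : ℕ} {Θ : Matrix (Fin n) (Fin n) ℝ} (f : Smooth Θ)
    (B : Fin n → Fin n → starDerivations Θ →ₗ[ℝ] Smooth Θ) (Z : starDerivations Θ)
    (X : VectorFields Θ) (k : Fin n) : (christoffelConnection f B).cov Z X k =
      (Z : Module.End ℂ (Smooth Θ)) (X k) + ∑ j, X j * B j k Z * expS (-f) := rfl

theorem starDerivation_one {n : ℕ} {Θ : Matrix (Fin n) (Fin n) ℝ} (Z : starDerivations Θ) :
    (Z : Module.End ℂ (Smooth Θ)) 1 = 0 := by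
  simpa using Z.2.1 1 1

theorem christoffelConnection_cov_partialVec {n : ℕ} {Θ : Matrix (Fin n) (Fin n) ℝ} (f : Smooth Θ)
    (B : Fin n → Fin n → starDerivations Θ →ₗ[ℝ] Smooth Θ) (Z : starDerivations Θ)
    (j k : Fin n) : (christoffelConnection f B).cov Z (partialVec Θ j) k =
      B j k Z * expS (-f) := by
  rw [christoffelConnection_cov, Finset.sum_eq_single j]
  · by_cases h : k = j
    · subst h
      simp [partialVec, starDerivation_one]
    · simp [partialVec, h]
  · intro i _ hi
    simp [partialVec, hi]
  · simp

/-- `hB` is compatibility on the basis. The factor `e^{-f}` in the connection cancels the `e^f` of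
the metric, and the Leibniz rule for `X_k e^f Y_k*` supplies the other terms. -/
theorem christoffelConnection_compatible {n : ℕ} {Θ : Matrix (Fin n) (Fin n) ℝ} (f : Smooth Θ)
    (hf : IsSelfAdjoint f) (B : Fin n → Fin n → starDerivations Θ →ₗ[ℝ] Smooth Θ)
    (hB : ∀ j k Z, B j k Z + star (B k j Z) =
      if j = k then (Z : Module.End ℂ (Smooth Θ)) (expS f) else 0)
    (Z : starDerivations Θ) (X Y : VectorFields Θ) :
    (Z : Module.End ℂ (Smooth Θ)) ((conformalMetric f hf).pairing X Y) =
      (conformalMetric f hf).pairing ((christoffelConnection f B).cov Z X) Y +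
        (conformalMetric f hf).pairing X ((christoffelConnection f B).cov Z Y) := by
  have hs : star (expS (-f)) = expS (-f) := (expS_nonneg (-f) hf.neg).1.star_eq
  have hkh := expS_neg_mul f
  have hhk := expS_mul_neg f
  have h1 : (conformalMetric f hf).pairing ((christoffelConnection f B).cov Z X) Y =
      ∑ k, (Z : Module.End ℂ (Smooth Θ)) (X k) * expS f * star (Y k) +
        ∑ k, ∑ j, X j * B j k Z * star (Y k) := by
    rw [conformalMetric_pairing, ← Finset.sum_add_distrib]
    refine Finset.sum_congr rfl fun k _ => ?_
    rw [christoffelConnection_cov, add_mul, add_mul, Finset.sum_mul, Finset.sum_mul]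
    congr 1
    refine Finset.sum_congr rfl fun j _ => ?_
    rw [mul_assoc _ (expS (-f)), hkh, mul_one]
  have h2 : (conformalMetric f hf).pairing X ((christoffelConnection f B).cov Z Y) =
      ∑ k, X k * expS f * star ((Z : Module.End ℂ (Smooth Θ)) (Y k)) +
        ∑ k, ∑ j, X j * star (B k j Z) * star (Y k) := by
    rw [Finset.sum_comm (γ := Fin n), conformalMetric_pairing, ← Finset.sum_add_distrib]
    refine Finset.sum_congr rfl fun k _ => ?_
    rw [christoffelConnection_cov, star_add, mul_add, star_sum, Finset.mul_sum]
    congr 1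
    refine Finset.sum_congr rfl fun j _ => ?_
    rw [star_mul, star_mul, hs, mul_assoc (X k), ← mul_assoc (expS f), hhk, one_mul, mul_assoc]
  have h3 : ∑ k, ∑ j, X j * B j k Z * star (Y k) + ∑ k, ∑ j, X j * star (B k j Z) * star (Y k) =
      ∑ k, X k * (Z : Module.End ℂ (Smooth Θ)) (expS f) * star (Y k) := by
    rw [← Finset.sum_add_distrib]
    refine Finset.sum_congr rfl fun k _ => ?_
    rw [← Finset.sum_add_distrib, Finset.sum_eq_single k]
    · rw [← add_mul, ← mul_add, hB, if_pos rfl]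
    · intro j _ hj
      rw [← add_mul, ← mul_add, hB, if_neg hj, mul_zero, zero_mul]
    · simp
  rw [h1, h2, add_add_add_comm, h3, conformalMetric_pairing, map_sum, ← Finset.sum_add_distrib,
    ← Finset.sum_add_distrib]
  refine Finset.sum_congr rfl fun k _ => ?_
  rw [Z.2.1, Z.2.1, Z.2.2, add_mul]
  abel

theorem exists_isLeviCivita {n : ℕ} {Θ : Matrix (Fin n) (Fin n) ℝ} (f : Smooth Θ)
    (hf : IsSelfAdjoint f) : ∃ D : Connection Θ, D.IsLeviCivita (conformalMetric f hf) := by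
  obtain ⟨l, hl⟩ := exists_dual_partialDer Θ
  have hh := (expS_nonneg f hf).1
  let ev : starDerivations Θ →ₗ[ℝ] Smooth Θ :=
    { toFun := fun Z => (Z : Module.End ℂ (Smooth Θ)) (expS f)
      map_add' := fun _ _ => rfl
      map_smul' := fun _ _ => rfl }
  let d : Fin n → Smooth Θ := fun i => delta Θ i (expS f)
  have hd : ∀ i, star (d i) = d i := fun i => by
    simp only [d]
    rw [← delta_star, hh.star_eq]
  have hev : ∀ Z, star (ev Z) = ev Z := fun Z => by
    change star ((Z : Module.End ℂ (Smooth Θ)) (expS f)) = _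
    rw [← Z.2.2, hh.star_eq]
    rfl
  -- `t` is the part of the Koszul expression antisymmetric in `j, k`. It cancels in the
  -- compatibility condition, so it may be extended to `𝒟_Θ` through the arbitrary `l i`; the
  -- symmetric part has to be `Z(e^f)` for every `Z`.
  let t : Fin n → Fin n → Fin n → Smooth Θ := fun i j k =>
    (if i = k then d j else 0) - if i = j then d k else 0
  have ht : ∀ i j k, star (t i j k) = t i j k := fun i j k => by
    simp only [t, star_sub, apply_ite star, hd, star_zero]
  have htt : ∀ i j k, t i j k + t i k j = 0 := fun i j k => by simp [t]
  let B : Fin n → Fin n → starDerivations Θ →ₗ[ℝ] Smooth Θ := fun j k =>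
    (2⁻¹ : ℝ) • ((if j = k then ev else 0) + ∑ i, (l i).smulRight (t i j k))
  have hBa : ∀ j k Z, B j k Z = (2⁻¹ : ℝ) • ((if j = k then ev Z else 0) +
      ∑ i, l i Z • t i j k) := fun j k Z => by
    by_cases h : j = k <;> simp [B, h, LinearMap.sum_apply]
  have hBs : ∀ j k Z, star (B j k Z) = B j k Z := fun j k Z => by
    rw [hBa, star_smul, star_add, star_sum, apply_ite star, hev, star_zero]
    simp [ht]
  have hBp : ∀ i j k, B j k (partialDer Θ i) = (2⁻¹ : ℝ) • ((if j = k then d i else 0) +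
      ((if i = k then d j else 0) - if i = j then d k else 0)) := fun i j k => by
    rw [hBa]
    have : ∑ x, l x (partialDer Θ i) • t x j k = t i j k := by
      simp [hl]
    rw [this]
    rfl
  refine ⟨christoffelConnection f B, ⟨christoffelConnection_compatible f hf B fun j k Z => ?_,
    fun i j => ?_, fun i j k => ?_⟩⟩
  · rw [hBs, hBa, hBa, ← smul_add, add_add_add_comm, ← Finset.sum_add_distrib]
    simp only [← smul_add, htt, smul_zero, Finset.sum_const_zero, add_zero, eq_comm (a := k)]
    by_cases h : j = k
    · simp only [h, if_true, ← two_smul ℝ (ev Z)]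
      rw [inv_smul_smul₀ two_ne_zero]
      rfl
    · simp [h]
  · ext1 k
    rw [christoffelConnection_cov_partialVec, christoffelConnection_cov_partialVec, hBp, hBp]
    simp only [eq_comm (a := j) (b := i)]
    congr 2
    abel
  · rw [pairing_partialVec, christoffelConnection_cov_partialVec, mul_assoc, expS_neg_mul, mul_one]
    exact hBs _ _ _

/-! ### The curvature of Levi-Civita connections -/

theorem partialDer_lie {n : ℕ} (Θ : Matrix (Fin n) (Fin n) ℝ) (i j : Fin n) :
    ⁅partialDer Θ i, partialDer Θ j⁆ = 0 := by
  apply Subtype.ext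
  refine LinearMap.ext fun a => ?_
  change delta Θ i (delta Θ j a) - delta Θ j (delta Θ i a) = 0
  rw [delta_comm, sub_self]

theorem conformalMetric_inverse {n : ℕ} {Θ : Matrix (Fin n) (Fin n) ℝ} (f : Smooth Θ)
    (hf : IsSelfAdjoint f) :
    (conformalMetric f hf).inverse = Matrix.diagonal fun _ => expS (-f) := by
  have h : (Matrix.of fun i j => (conformalMetric f hf).pairing (partialVec Θ i) (partialVec Θ j)) =
      Matrix.diagonal fun _ => expS f := by
    ext1 i j
    rw [Matrix.of_apply, conformalMetric_partialVec, Matrix.diagonal_apply]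
  -- `Ring.inverse` is zero on non-units, so the diagonal matrix is exhibited as a unit.
  let u : (Matrix (Fin n) (Fin n) (Smooth Θ))ˣ :=
    ⟨Matrix.diagonal fun _ => expS f, Matrix.diagonal fun _ => expS (-f),
      by simp [expS_mul_neg], by simp [expS_neg_mul]⟩
  rw [RiemannianMetric.inverse, h]
  exact Ring.inverse_unit u

theorem conformalMetric_scalarCurvature {n : ℕ} {Θ : Matrix (Fin n) (Fin n) ℝ} (f : Smooth Θ)
    (hf : IsSelfAdjoint f) (D : Connection Θ) : D.scalarCurvature (conformalMetric f hf) =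
      ∑ i, ∑ j, expS (-f) * (expS (-f) * D.riemann (conformalMetric f hf) i j i j) := by
  have hd : ∀ (i : Fin n) (F : Fin n → Smooth Θ),
      ∑ k, (Matrix.diagonal fun _ : Fin n => expS (-f)) i k * F k = expS (-f) * F i := by
    intro i F
    rw [Finset.sum_eq_single i]
    · rw [Matrix.diagonal_apply_eq]
    · intro k _ hk
      rw [Matrix.diagonal_apply_ne' _ hk, zero_mul]
    · simp
  simp only [Connection.scalarCurvature, Connection.ricci, conformalMetric_inverse]
  simp only [hd]
  simp only [Finset.mul_sum]

/-- Koszul's argument. Self-adjointness of the symbols replaces `⟨∂_j, D_i ∂_k⟩ = c_ikj*` by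
`c_ikj`, so the three cyclic compatibility equations involve the symbols alone. -/
theorem Connection.IsLeviCivita.christoffel {n : ℕ} {Θ : Matrix (Fin n) (Fin n) ℝ} {f : Smooth Θ}
    {hf : IsSelfAdjoint f} {D : Connection Θ} (hD : D.IsLeviCivita (conformalMetric f hf))
    (i j k : Fin n) :
    (conformalMetric f hf).pairing (D.cov (partialDer Θ i) (partialVec Θ j)) (partialVec Θ k) =
      (2⁻¹ : ℂ) • ((if j = k then delta Θ i (expS f) else 0) +
        (if i = k then delta Θ j (expS f) else 0) - if i = j then delta Θ k (expS f) else 0) := by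
  let c : Fin n → Fin n → Fin n → Smooth Θ := fun i j k =>
    (conformalMetric f hf).pairing (D.cov (partialDer Θ i) (partialVec Θ j)) (partialVec Θ k)
  have hs : ∀ i j k, c i j k = c j i k := fun i j k => by
    simp only [c, hD.torsion_free i j]
  have hc : ∀ i j k, c i j k + c i k j = if j = k then delta Θ i (expS f) else 0 := by
    intro i j k
    have h := hD.compatible (partialDer Θ i) (partialVec Θ j) (partialVec Θ k)
    rw [conformalMetric_partialVec, (conformalMetric f hf).hermitian (partialVec Θ j),
      (hD.real i k j).star_eq] at h
    rw [← h]
    change delta Θ i _ = _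
    split_ifs <;> simp
  have h1 := hc i j k
  have h2 := hc j i k
  have h3 := hc k i j
  rw [hs j i k] at h2
  rw [hs k i j, hs k j i] at h3
  rw [← h1, ← h2, ← h3, show c i j k + c i k j + (c i j k + c j k i) - (c i k j + c j k i) =
    (2 : ℂ) • c i j k by rw [two_smul]; abel, inv_smul_smul₀ two_ne_zero]

/-- Compatibility gives `⟨D_j D_i ∂_k, ∂_l⟩ = δ_j(c_ikl) - ⟨D_i ∂_k, D_j ∂_l⟩`, so `e^{-f}` is never
differentiated. The components of `D_i ∂_k` are `c_ikp e^{-f}`, and the bracket term of the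
curvature vanishes because the `∂_i` commute. -/
theorem Connection.IsLeviCivita.riemann {n : ℕ} {Θ : Matrix (Fin n) (Fin n) ℝ} {f : Smooth Θ}
    {hf : IsSelfAdjoint f} {D : Connection Θ} (hD : D.IsLeviCivita (conformalMetric f hf))
    {c : Fin n → Fin n → Fin n → Smooth Θ} (hc : ∀ i j k, c i j k =
      (conformalMetric f hf).pairing (D.cov (partialDer Θ i) (partialVec Θ j)) (partialVec Θ k))
    (i j k l : Fin n) : D.riemann (conformalMetric f hf) i j k l =
      delta Θ j (c i k l) - ∑ p, c i k p * expS (-f) * c j l p -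
        (delta Θ i (c j k l) - ∑ p, c j k p * expS (-f) * c i l p) := by
  have hs : star (expS (-f)) = expS (-f) := (expS_nonneg (-f) hf.neg).1.star_eq
  have hcov : ∀ i j k, D.cov (partialDer Θ i) (partialVec Θ j) k = c i j k * expS (-f) := by
    intro i j k
    rw [hc, pairing_partialVec, mul_assoc, expS_mul_neg, mul_one]
  have hstar : ∀ i j k, star (c i j k) = c i j k := fun i j k => by
    rw [hc]
    exact hD.real i j k
  have h2 : ∀ i j k l, (conformalMetric f hf).pairing
      (D.cov (partialDer Θ j) (D.cov (partialDer Θ i) (partialVec Θ k))) (partialVec Θ l) =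
      delta Θ j (c i k l) - ∑ p, c i k p * expS (-f) * c j l p := by
    intro i j k l
    have h := hD.compatible (partialDer Θ j) (D.cov (partialDer Θ i) (partialVec Θ k))
      (partialVec Θ l)
    rw [← hc, conformalMetric_pairing f hf (D.cov (partialDer Θ i) (partialVec Θ k))
      (D.cov (partialDer Θ j) (partialVec Θ l))] at h
    rw [eq_sub_iff_add_eq]
    refine Eq.trans ?_ h.symm
    congr 1
    refine Finset.sum_congr rfl fun p _ => ?_
    rw [hcov, hcov, star_mul, hs, hstar, mul_assoc (c i k p) (expS (-f)) (expS f), expS_neg_mul,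
      mul_one, mul_assoc]
  rw [Connection.riemann, Connection.curvature, partialDer_lie, map_zero, add_zero,
    pairing_partialVec, LinearMap.sub_apply, Pi.sub_apply, sub_mul, ← pairing_partialVec f hf,
    ← pairing_partialVec f hf]
  congr 1
  · exact h2 i j k l
  · exact h2 j i k l

theorem Connection.IsLeviCivita.riemann_sectional {n : ℕ} {Θ : Matrix (Fin n) (Fin n) ℝ}
    {f : Smooth Θ} {hf : IsSelfAdjoint f} {D : Connection Θ}
    (hD : D.IsLeviCivita (conformalMetric f hf)) (i j : Fin n) :
    D.riemann (conformalMetric f hf) i j i j =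
      if i = j then 0 else
        -(2⁻¹ : ℂ) • (delta Θ i (delta Θ i (expS f)) + delta Θ j (delta Θ j (expS f))) +
        (3 / 4 : ℂ) • (delta Θ i (expS f) * expS (-f) * delta Θ i (expS f) +
          delta Θ j (expS f) * expS (-f) * delta Θ j (expS f)) -
        (4⁻¹ : ℂ) • ∑ p, delta Θ p (expS f) * expS (-f) * delta Θ p (expS f) := by
  rw [hD.riemann fun i j k => (hD.christoffel i j k).symm]
  by_cases h : i = j
  · subst h
    simp
  · have h' : ¬ j = i := fun e => h e.symm
    -- `h1` evaluates the quadratic term pairing `c_iip` with `c_jjp`, and `h2` the one pairing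
    -- `c_jip` with `c_ijp`. Their difference yields the coefficients `3/4 = 1/2 + 1/4` and `-1/4`.
    have h1 : ∀ {R : Type} [Ring R] [Algebra ℂ R] (d : Fin n → R) (k : R),
        ∑ p, (2⁻¹ : ℂ) • ((if i = p then d i else 0) + (if i = p then d i else 0) - d p) * k *
          (2⁻¹ : ℂ) • ((if j = p then d j else 0) + (if j = p then d j else 0) - d p) =
        (4⁻¹ : ℂ) • (∑ p, d p * k * d p) - (2⁻¹ : ℂ) • (d i * k * d i + d j * k * d j) := by
      intro R _ _ d k
      simp only [smul_mul_assoc, mul_smul_comm, ← Finset.smul_sum, add_mul, mul_add, sub_mul,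
        mul_sub, ite_mul, mul_ite, zero_mul, mul_zero, Finset.sum_add_distrib,
        Finset.sum_sub_distrib, Finset.sum_ite_eq, Finset.mem_univ, if_true, h, if_false]
      module
    have h2 : ∀ {R : Type} [Ring R] [Algebra ℂ R] (d : Fin n → R) (k : R),
        ∑ p, (2⁻¹ : ℂ) • ((if i = p then d j else 0) + (if j = p then d i else 0)) * k *
          (2⁻¹ : ℂ) • ((if j = p then d i else 0) + (if i = p then d j else 0)) =
        (4⁻¹ : ℂ) • (d i * k * d i + d j * k * d j) := by
      intro R _ _ d k
      simp only [smul_mul_assoc, mul_smul_comm, ← Finset.smul_sum, add_mul, mul_add,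
        ite_mul, mul_ite, zero_mul, mul_zero, Finset.sum_add_distrib,
        Finset.sum_ite_eq, Finset.mem_univ, if_true, h, h', if_false]
      module
    have h3 := h1 (fun p => delta Θ p (expS f)) (expS (-f))
    have h4 := h2 (fun p => delta Θ p (expS f)) (expS (-f))
    simp only [if_true, h, h', if_false, sub_zero, zero_add, add_zero, zero_sub, map_smul,
      map_neg] at h3 h4 ⊢
    rw [h3, h4]
    module

/-! ### Scalar curvature in dimension four. -/

theorem Connection.IsLeviCivita.scalarCurvature_four {Θ : Matrix (Fin 4) (Fin 4) ℝ} {f : Smooth Θ}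
    {hf : IsSelfAdjoint f} {D : Connection Θ} (hD : D.IsLeviCivita (conformalMetric f hf)) :
    D.scalarCurvature (conformalMetric f hf) =
      ∑ i, (-(3 : ℂ) • (expS (-f) * expS (-f) * delta Θ i (delta Θ i (expS f))) +
        (3 / 2 : ℂ) • (expS (-f) * expS (-f) * delta Θ i (expS f) * expS (-f) *
          delta Θ i (expS f))) := by
  have h : ∑ i, ∑ j, D.riemann (conformalMetric f hf) i j i j =
      ∑ i, (-(3 : ℂ) • delta Θ i (delta Θ i (expS f)) +
        (3 / 2 : ℂ) • (delta Θ i (expS f) * expS (-f) * delta Θ i (expS f))) := by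
    -- Each index lies in 6 of the 12 ordered pairs `i ≠ j`: the second derivatives get `-6/2 = -3`,
    -- the quadratic terms `6 · 3/4 - 12 · 1/4 = 3/2`.
    simp only [hD.riemann_sectional, Fin.sum_univ_four]
    generalize delta Θ = d
    simp only [Fin.isValue, Fin.reduceEq, if_true, if_false]
    module
  rw [conformalMetric_scalarCurvature]
  simp only [← Finset.mul_sum]
  rw [h, ← mul_assoc, Finset.mul_sum]
  refine Finset.sum_congr rfl fun i _ => ?_
  rw [mul_add, mul_smul_comm, mul_smul_comm]
  simp only [mul_assoc]

theorem Connection.IsLeviCivita.scalarCurvature_eq_calc {Θ : Matrix (Fin 4) (Fin 4) ℝ}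
    {f : Smooth Θ} {hf : IsSelfAdjoint f} {D : Connection Θ}
    (hD : D.IsLeviCivita (conformalMetric f hf)) :
    (D.scalarCurvature (conformalMetric f hf) : Torus Θ) =
      -(3 : ℂ) • (NormedSpace.exp (-(f : Torus Θ)) *
        calc₁ K (modularDerivation ↑f) (∑ i, (delta Θ i (delta Θ i f) : Torus Θ))) +
      (3 : ℂ) • (NormedSpace.exp (-(f : Torus Θ)) *
        ∑ i, calc₂ H (modularDerivation ↑f) (delta Θ i f : Torus Θ) (delta Θ i f : Torus Θ)) := by
  rw [hD.scalarCurvature_four, calc₁_K_sum, Finset.mul_sum, Finset.mul_sum, Finset.smul_sum,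
    Finset.smul_sum, ← Finset.sum_add_distrib, AddSubmonoidClass.coe_finsetSum]
  refine Finset.sum_congr rfl fun i _ => ?_
  obtain ⟨hY, S, Q, hS, hQ, h⟩ := delta_expS_hasSum i f
  rw [calc₁_K_eq hS, calc₂_H_eq hY hQ]
  set E : Torus Θ := NormedSpace.exp (-(f : Torus Θ))
  set x : Torus Θ := (delta Θ i (expS f) : Torus Θ)
  have h1 : ((-(3 : ℂ) • (expS (-f) * expS (-f) * delta Θ i (delta Θ i (expS f))) +
      (3 / 2 : ℂ) • (expS (-f) * expS (-f) * delta Θ i (expS f) * expS (-f) *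
        delta Θ i (expS f)) : Smooth Θ) : Torus Θ) =
      -(3 : ℂ) • (E * (E * (delta Θ i (delta Θ i (expS f)) : Torus Θ))) +
        (3 / 2 : ℂ) • (E * ((E * x) * (E * x))) := by
    simp only [← mul_assoc]
    rfl
  -- With `Y = E * x` both sides are `E` times `-3 (S + 2Q) + (3/2) Y² = -3 S + 3 (½ Y² - 2Q)`.
  rw [h1, h, mul_add, mul_sub, mul_smul_comm, mul_smul_comm]
  module

end NCTorus

end

theorem mainTheorem9 (Θ : Matrix (Fin 4) (Fin 4) ℝ) (hΘ : Θ.transpose = -Θ)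
    (f : NCTorus.Smooth Θ) (hf : IsSelfAdjoint f) :
    (∃ D : NCTorus.Connection Θ, D.IsLeviCivita (NCTorus.conformalMetric f hf)) ∧
    (∀ x : NCTorus.Torus Θ, Summable (NCTorus.calcTerm NCTorus.K (NCTorus.modularDerivation ↑f) x)) ∧
    (∀ x y : NCTorus.Torus Θ,
      Summable (NCTorus.calcTerm₂ NCTorus.H (NCTorus.modularDerivation ↑f) x y)) ∧
    ∀ D : NCTorus.Connection Θ, D.IsLeviCivita (NCTorus.conformalMetric f hf) →
      D.scalarCurvature (NCTorus.conformalMetric f hf) =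
        ∑ i, (-(3 : ℂ) • (NCTorus.expS (-f) * NCTorus.expS (-f) *
            NCTorus.delta Θ i (NCTorus.delta Θ i (NCTorus.expS f))) +
          (3 / 2 : ℂ) • (NCTorus.expS (-f) * NCTorus.expS (-f) *
            NCTorus.delta Θ i (NCTorus.expS f) * NCTorus.expS (-f) *
            NCTorus.delta Θ i (NCTorus.expS f))) ∧
      (D.scalarCurvature (NCTorus.conformalMetric f hf) : NCTorus.Torus Θ) =
        -(3 : ℂ) • (NormedSpace.exp (-(f : NCTorus.Torus Θ)) *
          NCTorus.calc₁ NCTorus.K (NCTorus.modularDerivation ↑f)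
            (∑ i, (NCTorus.delta Θ i (NCTorus.delta Θ i f) : NCTorus.Torus Θ))) +
        (3 : ℂ) • (NormedSpace.exp (-(f : NCTorus.Torus Θ)) *
          ∑ i, NCTorus.calc₂ NCTorus.H (NCTorus.modularDerivation ↑f)
            (NCTorus.delta Θ i f : NCTorus.Torus Θ) (NCTorus.delta Θ i f : NCTorus.Torus Θ)) := by

  refine ⟨NCTorus.exists_isLeviCivita f hf, NCTorus.summable_calcTerm_K _,
    NCTorus.summable_calcTerm₂_H _, fun D hD => ⟨hD.scalarCurvature_four,
    hD.scalarCurvature_eq_calc⟩⟩
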